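/- Let $X$ be an irreducible, reduced, regular projective curve over $\mathbb F_q$, geometrically irreducible (field of constants $\mathbb F_q$), of genus $g=\dim H^1(X,\mathcal O_X)$. Let $\omega_1,\dots,\omega_{2g}$ be its Frobenius eigenvalues, so that $\#X(\mathbb F_{q^n})=q^n+1-\sum_i\omega_i^n$ for $n\ge1$; let $$\zeta_X(s)=\frac{\prod_{i=1}^{2g}(1-\omega_iq^{-s})}{(1-q^{-s})(1-q\,q^{-s})},\qquad \widehat\zeta_X(s)=q^{(g-1)s}\zeta_X(s)$$ be the Artin zeta function and the complete Artin zeta function. Let $\Phi$ be a reduced crystallographic root system (that of a split connected reductive group $G$ over the function field of $X$) with base $\Delta=\{\alpha_1,\dots,\alpha_n\}$, positive roots $\Phi^+$, negative roots $\Phi^-$, Weyl group $W$, Weyl vector $\rho=\frac12\sum_{\alpha\in\Phi^+}\alpha$, and fundamental weights $\lambda_j$ given by $\langle\lambda_j,\alpha_i^\vee\rangle=\delta_{ij}$. Put $\mathrm{ht}\,\alpha^\vee=\langle\rho,\alpha^\vee\rangle$ and $\Phi_w=\Phi^+\cap w^{-1}\Phi^-$. Fix $p\in\{1,\dots,n\}$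 (that is, a maximal standard parabolic subgroup $P$ of $G$), and let $\Delta_p=\Delta\setminus\{\alpha_p\}$, $\mathfrak W_p=\{w\in W: w\Delta_p\subset\Delta\cup\Phi^-\}$, $$N_{p,w}(k,h)=\#\{\alpha\in w^{-1}\Phi^-:\langle\lambda_p,\alpha^\vee\rangle=k,\ \mathrm{ht}\,\alpha^\vee=h\},\qquad M_p(k,h)=\max_{w\in\mathfrak W_p}\big(N_{p,w}(k,h-1)-N_{p,w}(k,h)\big).$$ With $\lambda=\rho+\sum_j s_j\lambda_j$, $s_j\in\mathbb C$, define the periods $$\omega_w^G(\lambda)=\prod_{\alpha\in\Delta}\frac1{1-q^{-\langle w\lambda-\rho,\alpha^\vee\rangle}}\prod_{\alpha\in\Phi_w}\frac{\widehat\zeta_X(\langle\lambda,\alpha^\vee\rangle)}{\widehat\zeta_X(\langle\lambda,\alpha^\vee\rangle+1)},\qquad \omega_X^G=\sum_{w\in W}\omega_w^G,$$ and let $\omega_X^{(G,P)}(s)$, $s=s_p$, be the iterated residue of $\omega_X^G(\lambda)$ at $s_j=0$ for all $j\ne p$, taken in any fixed order. (1) As meromorphic functions of $s$ (that is, outside a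 closed discrete set), the iterated residue of $\omega_w^G$ is $0$ for $w\notin\mathfrak W_p$, and for $w\in\mathfrak W_p$ it is $$T_w(s)=\Big(\frac1{\log q}\Big)^{\#(w^{-1}\Delta\cap\Delta_p)}\big(\mathrm{Res}_{s=1}\widehat\zeta_X(s)\big)^{\#(\Phi_w\cap\Delta_p)}\prod_{\alpha\in w^{-1}\Delta\setminus\Delta_p}\frac1{1-q^{-\langle\lambda_p,\alpha^\vee\rangle s-\mathrm{ht}\,\alpha^\vee+1}}\cdot\frac{\prod_{\alpha\in\Phi_w\setminus\Delta_p}\widehat\zeta_X(\langle\lambda_p,\alpha^\vee\rangle s+\mathrm{ht}\,\alpha^\vee)}{\prod_{\alpha\in\Phi_w}\widehat\zeta_X(\langle\lambda_p,\alpha^\vee\rangle s+\mathrm{ht}\,\alpha^\vee+1)};$$ hence $\omega_X^{(G,P)}(s)=\sum_{w\in\mathfrak W_p}T_w(s)$. (2) Regard the $\widehat\zeta_X(as+b)$ in $T_w$ as formal symbols indexed by $(a,b)$. Among the finite families (multisets) of zeta factors whose product with every term $T_w$, $w\in\mathfrak W_p$, has after cancellation no zeta factor left in the denominator, there is exactly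 one, $\big(\widehat\zeta_X(a_is+b_i)\big)_{1\le i\le I(G,P)}$, with the minimal number of members. It consists of the $\widehat\zeta_X(ks+h)$ with integers $k\ge0$, $h\ge2$, each with multiplicity $M_p(k,h)$. (3) Consequently the zeta function $\widehat\zeta_X^{(G,P)}(s):=\prod_{i=1}^{I(G,P)}\widehat\zeta_X(a_is+b_i)\cdot\omega_X^{(G,P)}(s)$ of $X$ associated to $(G,P)$ is $$\widehat\zeta_X^{(G,P)}(s)=\omega_X^{(G,P)}(s)\cdot\prod_{k=0}^\infty\prod_{h=2}^\infty\widehat\zeta_X(ks+h)^{M_p(k,h)}.$$ -/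

import Mathlib

open AlgebraicGeometry CategoryTheory

open scoped Polynomial Topology

/-! ### Curves over finite fields and their Artin zeta functions -/

universe u

section Curve

attribute [local instance] MvPolynomial.gradedAlgebra

/-- The projective space of dimension `n` over `k`, as a morphism `ℙⁿ ⟶ Spec k`. -/
noncomputable def projectiveSpaceHom (k : Type u) [Field k] (n : ℕ) :
    Proj (MvPolynomial.homogeneousSubmodule (Fin (n + 1)) k) ⟶ Spec (.of k) :=
  Proj.toSpecZero (MvPolynomial.homogeneousSubmodule (Fin (n + 1)) k) ≫
    Spec.map (CommRingCat.ofHom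
      (algebraMap k (MvPolynomial.homogeneousSubmodule (Fin (n + 1)) k 0)))

/-- `f : X ⟶ Spec k` makes `X` an irreducible, reduced, regular projective curve over `k`
(with field of constants `k`, that is, geometrically irreducible). -/
structure IsRegularProjectiveCurve {k : Type u} [Field k] {X : Scheme.{u}}
    (f : X ⟶ Spec (.of k)) : Prop where
  isIntegral : IsIntegral X
  regular : ∀ x : X, IsRegularLocalRing (X.presheaf.stalk x)
  projective : ∃ (n : ℕ)
    (i : X ⟶ Proj (MvPolynomial.homogeneousSubmodule (Fin (n + 1)) k)),
    IsClosedImmersion i ∧ i ≫ projectiveSpaceHom k n = f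
  dim_eq_one : topologicalKrullDim X = 1
  geometricallyIrreducible : GeometricallyIrreducible f

/-- The structure sheaf as a sheaf of abelian groups. -/
noncomputable def structureSheafAb (X : Scheme.{u}) :
    Sheaf (Opens.grothendieckTopology X) AddCommGrpCat.{u} :=
  (sheafCompose _ (forget₂ CommRingCat RingCat.{u} ⋙ forget₂ RingCat AddCommGrpCat.{u})).obj X.sheaf

/-- The genus `dim_k H¹(X, 𝒪_X)` of a curve over a finite field `k`; since `k` is finite, the
dimension is the logarithm to base `#k` of the number of elements. -/
noncomputable def curveGenus {k : Type u} [Field k] {X : Scheme.{u}}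
    (_f : X ⟶ Spec (.of k)) : ℕ :=
  Nat.log (Nat.card k) (Nat.card (Sheaf.H.{u} (structureSheafAb X) 1))

/-- The number of points of `X` over the extension of degree `n` of the finite field `k`; this
extension is the splitting field of `T ^ (#k) ^ n - T`. -/
noncomputable def pointCount {k : Type u} [Field k] {X : Scheme.{u}}
    (f : X ⟶ Spec (.of k)) (n : ℕ) : ℕ :=
  Nat.card {x : Spec (.of (Polynomial.X ^ Nat.card k ^ n - Polynomial.X : k[X]).SplittingField) ⟶ X //
    x ≫ f = Spec.map (CommRingCat.ofHom (algebraMap k _))}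

/-- The Frobenius eigenvalues `ω_1, …, ω_{2g}` of a curve over a finite field with `q` elements:
the complex numbers, unique up to order, with `#X(𝔽_{q^n}) = q^n + 1 - ∑ ω_i^n` for all `n ≥ 1`. -/
noncomputable def frobeniusEigenvalues {k : Type u} [Field k] {X : Scheme.{u}}
    (f : X ⟶ Spec (.of k)) : Fin (2 * curveGenus f) → ℂ :=
  open Classical in
  if h : ∃ ω : Fin (2 * curveGenus f) → ℂ, ∀ n : ℕ, 1 ≤ n →
      (pointCount f n : ℂ) = (Nat.card k : ℂ) ^ n + 1 - ∑ i, ω i ^ n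
  then h.choose else 0

/-- The Artin zeta function
`ζ_X(s) = ∏ (1 - ω_i q^{-s}) / ((1 - q^{-s}) (1 - q q^{-s}))`, on the whole complex plane. -/
noncomputable def artinZeta {k : Type u} [Field k] {X : Scheme.{u}}
    (f : X ⟶ Spec (.of k)) (s : ℂ) : ℂ :=
  (∏ i, (1 - frobeniusEigenvalues f i * (Nat.card k : ℂ) ^ (-s))) /
    ((1 - (Nat.card k : ℂ) ^ (-s)) * (1 - (Nat.card k : ℂ) * (Nat.card k : ℂ) ^ (-s)))

/-- The complete Artin zeta function: a line bundle of degree `d` is weighted by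
`(q^{-s})^{χ} = (q^{-s})^{d - (g - 1)}`, so `ζ̂_X(s) = q^{(g - 1) s} ζ_X(s)`. -/
noncomputable def completeZeta {k : Type u} [Field k] {X : Scheme.{u}}
    (f : X ⟶ Spec (.of k)) (s : ℂ) : ℂ :=
  (Nat.card k : ℂ) ^ (((curveGenus f : ℂ) - 1) * s) * artinZeta f s

end Curve

/-! ### Residues -/

section Residue

/-- The residue at `a` of a function that is holomorphic in a punctured neighbourhood of `a`:
the value of `(2πi)⁻¹ ∮_{|z - a| = r} f(z) dz` for all small `r > 0`. -/
noncomputable def residueAt (f : ℂ → ℂ) (a : ℂ) : ℂ :=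
  Filter.limUnder (𝓝[>] (0 : ℝ)) fun r => (2 * Real.pi * Complex.I)⁻¹ * ∮ z in C(a, r), f z

/-- Iterated residue of a function of several variables along the hyperplanes `s_j = 0`, for `j` in
the list `l`, the head of the list being taken first. The result does not depend on the
coordinates `s_j` with `j ∈ l`. -/
noncomputable def iteratedResidue {J : Type*} [DecidableEq J] :
    List J → ((J → ℂ) → ℂ) → (J → ℂ) → ℂ
  | [], F => F
  | j :: l, F => iteratedResidue l fun s => residueAt (fun z => F (Function.update s j z)) 0

end Residue

/-! ### Root systems

The root system of a split connected reductive group is a reduced crystallographic root system `P`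
in the complexification `M` of `V`, with dual space `N`; `⟨x, α^∨⟩` is `P.toLinearMap x (P.coroot i)`
if `α = P.root i`. A base `b` has the simple roots `P.root j` for `j ∈ b.support`, and a maximal
standard parabolic subgroup corresponds to `p : b.support`. -/

namespace RootPairing.Base

open scoped Classical

variable {ι M N : Type*} [Fintype ι] [AddCommGroup M] [Module ℂ M] [AddCommGroup N] [Module ℂ N]
  {P : RootPairing ι ℂ M N} (b : P.Base)

/-- The Weyl vector, half the sum of the positive roots. -/
noncomputable def weylVector : M :=
  (2 : ℂ)⁻¹ • ∑ i with b.IsPos i, P.root i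

/-- The fundamental weight `λ_j`, defined by `⟨λ_j, α_i^∨⟩ = δ_{ij}` for all simple `α_i`. -/
noncomputable def fundamentalWeight [P.IsRootSystem] (j : b.support) : M :=
  P.toLinearMap.toPerfPair.symm (b.toCoweightBasis.coord j)

/-- `Φ_w = Φ⁺ ∩ w⁻¹Φ⁻`, as a set of indices. -/
noncomputable def inversionSet (w : P.weylGroup) : Finset ι :=
  {i | b.IsPos i ∧ ¬ b.IsPos (P.weylGroupToPerm w i)}

/-- `Δ_p = Δ ∖ {α_p}`, as a set of indices. -/
noncomputable def leviBase (p : b.support) : Finset ι :=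
  b.support.erase p

/-- `𝔚_p`, the set of `w` with `w Δ_p ⊆ Δ ∪ Φ⁻`. -/
def specialWeyl (p : b.support) : Set P.weylGroup :=
  {w | ∀ j ∈ b.leviBase p, P.weylGroupToPerm w j ∈ b.support ∨ ¬ b.IsPos (P.weylGroupToPerm w j)}

/-- The height `ht α^∨ = ⟨ρ, α^∨⟩`. -/
noncomputable def corootHeight (i : ι) : ℂ :=
  P.toLinearMap b.weylVector (P.coroot i)

/-- `⟨λ_p, α^∨⟩`. -/
noncomputable def corootCoeff [P.IsRootSystem] (p : b.support) (i : ι) : ℂ :=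
  P.toLinearMap (b.fundamentalWeight p) (P.coroot i)

/-- `N_{p,w}(k,h) = #{α ∈ w⁻¹Φ⁻ : ⟨λ_p, α^∨⟩ = k, ht α^∨ = h}`. -/
noncomputable def countN [P.IsRootSystem] (p : b.support) (w : P.weylGroup) (k h : ℤ) : ℕ :=
  Finset.card {i : ι | ¬ b.IsPos (P.weylGroupToPerm w i) ∧
    b.corootCoeff p i = k ∧ b.corootHeight i = h}

/-- `M_p(k,h) = max_{w ∈ 𝔚_p} (N_{p,w}(k,h-1) - N_{p,w}(k,h))`. -/
noncomputable def countM [P.IsRootSystem] (p : b.support) (k h : ℤ) : ℤ :=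
  ⨆ w : b.specialWeyl p, ((b.countN p w k (h - 1) : ℤ) - b.countN p w k h)

/-! ### Periods -/

/-- The summand `ω_w^G(λ)` of the period; `q` is the number of elements of the base field and
`Z` is the complete Artin zeta function of the curve. -/
noncomputable def periodTerm (q : ℕ) (Z : ℂ → ℂ) (w : P.weylGroup) (lam : M) : ℂ :=
  (∏ i ∈ b.support,
      1 / (1 - (q : ℂ) ^ (-(P.toLinearMap (w • lam - b.weylVector) (P.coroot i))))) *
    ∏ i ∈ b.inversionSet w,
      Z (P.toLinearMap lam (P.coroot i)) / Z (P.toLinearMap lam (P.coroot i) + 1)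

/-- The period `ω_X^G(λ) = ∑_{w ∈ W} ω_w^G(λ)`; the Weyl group is finite. -/
noncomputable def period (q : ℕ) (Z : ℂ → ℂ) (lam : M) : ℂ :=
  ∑ᶠ w : P.weylGroup, b.periodTerm q Z w lam

/-- The coordinates `λ = ρ + ∑ s_j λ_j`. -/
noncomputable def weightOfCoord [P.IsRootSystem] (s : b.support → ℂ) : M :=
  b.weylVector + ∑ j, s j • b.fundamentalWeight j

/-- For `F` a function of `λ`, the iterated residue along `s_j = 0` for all `j` in `l`, as a function
of `s = s_p`; here `l` enumerates the simple roots other than `α_p`. -/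
noncomputable def parabolicResidue [P.IsRootSystem] (p : b.support) (l : List b.support)
    (F : M → ℂ) (s : ℂ) : ℂ :=
  iteratedResidue l (fun t => F (b.weightOfCoord t)) (Pi.single p s)

/-- The period `ω_X^{(G,P)}(s)` of `(G,P)`. -/
noncomputable def parabolicPeriod [P.IsRootSystem] (q : ℕ) (Z : ℂ → ℂ) (p : b.support)
    (l : List b.support) (s : ℂ) : ℂ :=
  b.parabolicResidue p l (b.period q Z) s

/-! ### Zeta factors and the group zeta function

A zeta factor `ζ̂_X(a s + c)` is recorded by the pair `(a, c)`, a product of zeta factors by a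
multiset of pairs. -/

/-- The zeta factors in the numerator of the term of `w ∈ 𝔚_p` in `ω_X^{(G,P)}(s)`:
`ζ̂_X(⟨λ_p, α^∨⟩ s + ht α^∨)` for `α ∈ Φ_w ∖ Δ_p`. (The roots in `Φ_w ∩ Δ_p` contribute only the
constant `Res_{s=1} ζ̂_X(s)` there.) -/
noncomputable def zetaNumerator [P.IsRootSystem] (p : b.support) (w : P.weylGroup) :
    Multiset (ℂ × ℂ) :=
  (b.inversionSet w \ b.leviBase p).val.map fun i => (b.corootCoeff p i, b.corootHeight i)

/-- The zeta factors in the denominator of the term of `w ∈ 𝔚_p` in `ω_X^{(G,P)}(s)`: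
`ζ̂_X(⟨λ_p, α^∨⟩ s + ht α^∨ + 1)` for `α ∈ Φ_w`. -/
noncomputable def zetaDenominator [P.IsRootSystem] (p : b.support) (w : P.weylGroup) :
    Multiset (ℂ × ℂ) :=
  (b.inversionSet w).val.map fun i => (b.corootCoeff p i, b.corootHeight i + 1)

/-- Multiplication by the zeta factors in `m` leaves, after cancellation, no zeta factor in the
denominator of any term of `ω_X^{(G,P)}(s)`. -/
def ClearsDenominators [P.IsRootSystem] (p : b.support) (m : Multiset (ℂ × ℂ)) : Prop :=
  ∀ w ∈ b.specialWeyl p, b.zetaDenominator p w ≤ m + b.zetaNumerator p w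

/-- `m` is a family of zeta factors that clears all denominators, with the minimal number of
members. -/
def IsMinimalNormalization [P.IsRootSystem] (p : b.support) (m : Multiset (ℂ × ℂ)) : Prop :=
  b.ClearsDenominators p m ∧ ∀ m', b.ClearsDenominators p m' → m.card ≤ m'.card

/-- The minimal normalizing zeta factors `(a_i, b_i)`, `1 ≤ i ≤ I(G,P)`. -/
noncomputable def minimalFactors [P.IsRootSystem] (p : b.support) : Multiset (ℂ × ℂ) :=
  Classical.epsilon (b.IsMinimalNormalization p)

/-- The product of the zeta factors in `m`, at `s`. -/
noncomputable def zetaProduct (Z : ℂ → ℂ) (m : Multiset (ℂ × ℂ)) (s : ℂ) : ℂ :=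
  (m.map fun x => Z (x.1 * s + x.2)).prod

/-- The zeta function `ζ̂_X^{(G,P)}(s) = ∏_i ζ̂_X(a_i s + b_i) · ω_X^{(G,P)}(s)`. -/
noncomputable def groupZeta [P.IsRootSystem] (q : ℕ) (Z : ℂ → ℂ) (p : b.support)
    (l : List b.support) (s : ℂ) : ℂ :=
  zetaProduct Z (b.minimalFactors p) s * b.parabolicPeriod q Z p l s

/-- The residue of `ω_w^G` for `w ∈ 𝔚_p` in closed form. -/
noncomputable def residueTerm [P.IsRootSystem] (q : ℕ) (Z : ℂ → ℂ) (p : b.support)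
    (w : P.weylGroup) (s : ℂ) : ℂ :=
  (1 / (Real.log q : ℂ)) ^ Finset.card {i ∈ b.leviBase p | P.weylGroupToPerm w i ∈ b.support} *
    residueAt Z 1 ^ (b.inversionSet w ∩ b.leviBase p).card *
    (∏ i with P.weylGroupToPerm w i ∈ b.support ∧ i ∉ b.leviBase p,
      1 / (1 - (q : ℂ) ^ (-(b.corootCoeff p i * s) - b.corootHeight i + 1))) *
    (zetaProduct Z (b.zetaNumerator p w) s / zetaProduct Z (b.zetaDenominator p w) s)

end RootPairing.Base

/-! ### Residues at simple poles -/

/-! Put λ = ρ + ∑ t_j λ_j, and let t₀ be the point with t_p = s and the other t_j = 0. After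
reindexing by w, the term of w is built from the affine functions v_α(t) = ⟨λ, α^∨⟩: a factor 1/(1 -
q^{-(v_α - 1)}) for α ∈ w⁻¹Δ and a factor ζ̂(v_α)/ζ̂(v_α + 1) for α ∈ Φ_w. If ⟨λ_p, α^∨⟩ ≠ 0, the
factor is regular at t₀ for generic s. Otherwise v_α(t₀) is the integer ht α^∨, and the factor can
be singular only if this integer is 1, which forces α ∈ Δ_p; then v_α - 1 is a coordinate t_j. As
w⁻¹Δ and Φ_w are disjoint, no pole is worse than simple. So the term equals ∏_{j ≠ p} t_j⁻¹ · H_w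
with H_w analytic at t₀ (`exists_regularPart_periodTerm`), and its iterated residue, in any order,
is H_w(t₀) (`iteratedResidue_eq_of_simplePoles`). Each α_j ∈ Δ_p outside w⁻¹Δ ∪ Φ_w leaves a factor
t_j in H_w, so the residue vanishes unless w ∈ 𝔚_p.

This needs ζ̂ to be regular and nonzero at the integers n ≥ 2, for which |ω_i| ≤ q suffices. The
bound follows from the crude estimate #X(𝔽_{q^n}) = O(q^n), obtained by Noether normalization on
affine charts, together with an interpolation argument on power sums (`norm_le_of_norm_sum_pow_le`);
the Riemann hypothesis for curves is not needed.

The normalization is order theory of multisets. A family clears the term of w exactly when it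
contains denominator minus numerator (truncated), so the admissible families are those above the
supremum over 𝔚_p; this least family is the unique one of minimal size. Multiplicities are read off
by counting coroots. -/

open Filter in
/-- The residue of a function with at most a simple pole. -/
theorem residueAt_eq_of_simplePole {f h : ℂ → ℂ} {a : ℂ} (hh : AnalyticAt ℂ h a)
    (hf : ∀ᶠ z in 𝓝[≠] a, f z = (z - a)⁻¹ * h z) : residueAt f a = h a := by
  have hd : ∀ᶠ z in 𝓝 a, DifferentiableAt ℂ h z :=
    hh.eventually_analyticAt.mono fun z hz => hz.differentiableAt
  obtain ⟨R, hR, hball⟩ := Metric.eventually_nhds_iff_ball.1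
    (hd.and (eventually_nhdsWithin_iff.1 hf))
  refine Tendsto.limUnder_eq (tendsto_const_nhds.congr' ?_)
  -- By Cauchy's formula the circle integral is the same for all 0 < r < R, so the limit is that of
  -- an eventually constant function.
  filter_upwards [Ioo_mem_nhdsGT hR] with r hr
  have hsub : Metric.closedBall a r ⊆ Metric.ball a R := Metric.closedBall_subset_ball hr.2
  have hcongr : (∮ z in C(a, r), f z) = ∮ z in C(a, r), (z - a)⁻¹ • h z := by
    refine circleIntegral.integral_congr hr.1.le fun z hz => ?_
    have hza : z ≠ a := by
      rintro rfl
      simp [hr.1.ne] at hz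
    exact (hball z (hsub (Metric.sphere_subset_closedBall hz))).2 hza
  have hintegral := DifferentiableOn.circleIntegral_sub_inv_smul (c := a) (R := r) (w := a) (f := h)
    (fun z hz => (hball z (hsub hz)).1.differentiableWithinAt) (Metric.mem_ball_self hr.1)
  have hpi : (2 * Real.pi * Complex.I : ℂ) ≠ 0 := by simp [Real.pi_ne_zero]
  rw [hcongr, hintegral, smul_eq_mul, inv_mul_cancel_left₀ hpi]

open Filter in
/-- The iterated residue of a function with at most simple poles along the coordinate
hyperplanes. -/
theorem iteratedResidue_eq_of_simplePoles {J : Type*} [DecidableEq J] [Fintype J] {l : List J}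
    (hl : l.Nodup) {F H : (J → ℂ) → ℂ} {t₀ : J → ℂ} (h₀ : ∀ j ∈ l, t₀ j = 0)
    (hH : AnalyticAt ℂ H t₀)
    (hF : ∀ᶠ t in 𝓝 t₀, (∀ j ∈ l, t j ≠ 0) → F t = (l.map fun j => (t j)⁻¹).prod * H t) :
    iteratedResidue l F t₀ = H t₀ := by
  induction l generalizing F H with
  | nil =>
    have := hF.self_of_nhds (by simp)
    simpa [iteratedResidue] using this
  | cons j l ih =>
    have hj : Function.update t₀ j 0 = t₀ := by
      rw [← h₀ j (by simp), Function.update_eq_self]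
    have hupd : AnalyticAt ℂ (fun s : J → ℂ => Function.update s j (0 : ℂ)) t₀ := by
      refine AnalyticAt.pi fun i => ?_
      rcases eq_or_ne i j with rfl | hij
      · simpa using analyticAt_const
      · simp only [Function.update_of_ne hij]
        exact (ContinuousLinearMap.proj (R := ℂ) (φ := fun _ : J => ℂ) i).analyticAt t₀
    have hcont : Tendsto (fun s : J → ℂ => Function.update s j (0 : ℂ)) (𝓝 t₀) (𝓝 t₀) := by
      simpa [ContinuousAt, hj] using hupd.continuousAt
    have hline (s : J → ℂ) : AnalyticAt ℂ (fun z : ℂ => Function.update s j z) 0 := by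
      refine AnalyticAt.pi fun i => ?_
      rcases eq_or_ne i j with rfl | hij
      · simp only [Function.update_self]
        exact analyticAt_id
      · simpa [Function.update_of_ne hij] using analyticAt_const
    -- The inner residue sets the j-th coordinate of H to 0 and leaves the poles along the other
    -- hyperplanes, so induction applies to this restriction of H. It must be computed at all s near
    -- t₀, hence `eventually_nhds`.
    have key : iteratedResidue l (fun s => residueAt (fun z => F (Function.update s j z)) 0) t₀ =
        H (Function.update t₀ j 0) := by
      refine ih (H := fun s => H (Function.update s j 0)) hl.of_cons
        (fun i hi => h₀ i (by simp [hi])) (hH.comp_of_eq hupd hj) ?_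
      filter_upwards [hcont.eventually hF.eventually_nhds,
        hcont.eventually hH.eventually_analyticAt] with s hs hs' hne
      set c := (l.map fun i => (s i)⁻¹).prod with hc
      refine residueAt_eq_of_simplePole (h := fun z => c * H (Function.update s j z))
        (analyticAt_const.mul (hs'.fun_comp (hline s))) ?_
      filter_upwards [nhdsWithin_le_nhds ((hline s).continuousAt.eventually hs),
        self_mem_nhdsWithin] with z hz hz0
      have hmap : (l.map fun i => (Function.update s j z i)⁻¹) = l.map fun i => (s i)⁻¹ := by
        refine List.map_congr_left fun i hi => ?_
        rw [Function.update_of_ne]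
        rintro rfl
        exact (List.nodup_cons.1 hl).1 hi
      rw [hz ?_]
      · simp [hmap, hc, mul_assoc]
      · intro i hi
        rcases List.mem_cons.1 hi with rfl | hi'
        · simpa using hz0
        · rw [Function.update_of_ne]
          · exact hne i hi'
          · rintro rfl
            exact (List.nodup_cons.1 hl).1 hi'
    rw [hj] at key
    exact key

/-! ### Functions with the analytic properties of a complete zeta function -/

/-- A nonconstant affine map is continuous and injective, so it carries punctured neighbourhoods
into punctured neighbourhoods. -/
theorem tendsto_affine_codiscrete {a : ℂ} (ha : a ≠ 0) (c : ℂ) :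
    Filter.Tendsto (fun s => a * s + c) (Filter.codiscrete ℂ) (Filter.codiscrete ℂ) := by
  intro S hS
  have hS' : ∀ x, S ∈ 𝓝[≠] x := by simpa [mem_codiscrete] using hS
  have : ∀ x, (fun s => a * s + c) ⁻¹' S ∈ 𝓝[≠] x := by
    intro x
    have ht : Filter.Tendsto (fun s => a * s + c) (𝓝[≠] x) (𝓝[≠] (a * x + c)) := by
      refine tendsto_nhdsWithin_iff.2 ⟨?_, ?_⟩
      · exact (Continuous.tendsto (by fun_prop) x).mono_left nhdsWithin_le_nhds
      · filter_upwards [self_mem_nhdsWithin] with z hz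
        simpa [ha] using hz
    exact ht (hS' _)
  simpa [mem_codiscrete] using this

/-- The properties of a complete zeta function used in the computation of residues: it is
generically holomorphic without zeros, it is so at the integers `n ≥ 2`, and it has at most a
simple pole at `1`. -/
structure IsZetaLike (Z : ℂ → ℂ) : Prop where
  generic : ∀ᶠ s in Filter.codiscrete ℂ, AnalyticAt ℂ Z s ∧ Z s ≠ 0
  regular : ∀ n : ℕ, 2 ≤ n → AnalyticAt ℂ Z n ∧ Z n ≠ 0
  pole : ∃ h : ℂ → ℂ, AnalyticAt ℂ h 1 ∧ ∀ᶠ s in 𝓝[≠] (1 : ℂ), Z s = (s - 1)⁻¹ * h s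

theorem IsZetaLike.eventually_affine {Z : ℂ → ℂ} (hZ : IsZetaLike Z) {a : ℂ} (ha : a ≠ 0)
    (c : ℂ) : ∀ᶠ s in Filter.codiscrete ℂ, AnalyticAt ℂ Z (a * s + c) ∧ Z (a * s + c) ≠ 0 :=
  (tendsto_affine_codiscrete ha c).eventually hZ.generic

section QPower

variable {q : ℕ}

theorem analyticAt_natCast_cpow_neg (hq : 1 < q) (s : ℂ) :
    AnalyticAt ℂ (fun z : ℂ => (q : ℂ) ^ (-z)) s := by
  have hq0 : (q : ℂ) ≠ 0 := by exact_mod_cast (by omega : q ≠ 0)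
  have : (fun z : ℂ => (q : ℂ) ^ (-z)) = fun z => Complex.exp (Complex.log q * -z) := by
    funext z
    rw [Complex.cpow_def_of_ne_zero hq0]
  rw [this]
  fun_prop

theorem eventually_one_sub_mul_cpow_neg_ne_zero (hq : 1 < q) (a : ℂ) :
    ∀ᶠ s in Filter.codiscrete ℂ, 1 - a * (q : ℂ) ^ (-s) ≠ 0 := by
  have hq0 : (q : ℂ) ≠ 0 := by exact_mod_cast (by omega : q ≠ 0)
  have han : AnalyticOnNhd ℂ (fun s : ℂ => 1 - a * (q : ℂ) ^ (-s)) Set.univ := fun s _ =>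
    analyticAt_const.sub (analyticAt_const.mul (analyticAt_natCast_cpow_neg hq s))
  have hx : ∃ x : ℂ, 1 - a * (q : ℂ) ^ (-x) ≠ 0 := by
    -- Vanishing at 0 gives a = 1, and then vanishing at -1 gives q = 1. The zeros of an entire
    -- function that is not identically zero form a discrete set.
    by_contra! h
    have h0 := h 0
    have h1 := h (-1)
    simp only [neg_zero, Complex.cpow_zero, mul_one, neg_neg, Complex.cpow_one] at h0 h1
    have ha : a = 1 := by linear_combination -h0
    rw [ha, one_mul, sub_eq_zero] at h1
    exact absurd (by exact_mod_cast h1.symm : q = 1) (by omega)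
  obtain ⟨x, hx⟩ := hx
  exact han.preimage_zero_mem_codiscrete (x := x) hx

theorem natCast_cpow_neg_intCast_ne_one (hq : 1 < q) {m : ℤ} (hm : m ≠ 0) :
    (q : ℂ) ^ (-(m : ℂ)) ≠ 1 := by
  rw [← Int.cast_neg, Complex.cpow_intCast]
  intro h
  have h' : (q : ℝ) ^ (-m) = 1 := by
    apply Complex.ofReal_injective
    push_cast
    exact h
  have := (zpow_eq_one_iff_right₀ (by positivity) (by exact_mod_cast hq.ne')).1 h'
  omega

theorem analyticAt_inv_one_sub_cpow_neg (hq : 1 < q) {s : ℂ} (hs : 1 - (q : ℂ) ^ (-s) ≠ 0) :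
    AnalyticAt ℂ (fun z : ℂ => 1 / (1 - (q : ℂ) ^ (-z))) s :=
  analyticAt_const.div (analyticAt_const.sub (analyticAt_natCast_cpow_neg hq s)) hs

theorem hasDerivAt_one_sub_cpow_neg (hq : 1 < q) :
    HasDerivAt (fun z : ℂ => 1 - (q : ℂ) ^ (-z)) (Real.log q : ℂ) 0 := by
  have hq0 : (q : ℂ) ≠ 0 := by exact_mod_cast (by omega : q ≠ 0)
  have h1 : HasDerivAt (fun z : ℂ => (q : ℂ) ^ (-z))
      ((q : ℂ) ^ (-(0 : ℂ)) * Complex.log q * -1) 0 :=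
    (hasDerivAt_neg' (0 : ℂ)).const_cpow (Or.inl hq0)
  refine (h1.const_sub 1).congr_deriv ?_
  rw [Complex.ofReal_log (Nat.cast_nonneg q)]
  simp

/-- At a simple zero of `f`, the function `1 / f` has a simple pole whose residue is the inverse of
the derivative of `f`. -/
theorem exists_simplePole_of_simpleZero {f : ℂ → ℂ} {a d : ℂ} (hf : AnalyticAt ℂ f a)
    (h0 : f a = 0) (hd : HasDerivAt f d a) (hd0 : d ≠ 0) :
    ∃ e : ℂ → ℂ, AnalyticAt ℂ e a ∧ e a = 1 / d ∧
      ∀ᶠ z in 𝓝[≠] a, 1 / f z = (z - a)⁻¹ * e z := by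
  -- The quotient of f by z - a is the slope function `dslope f a`, analytic also at a.
  have hord : ∃ g : ℂ → ℂ, AnalyticAt ℂ g a ∧ ∀ᶠ z in 𝓝 a, f z = (z - a) * g z := by
    refine ⟨dslope f a, ?_, ?_⟩
    · obtain ⟨p, hp⟩ := hf
      exact ⟨p.fslope, hp.has_fpower_series_dslope_fslope⟩
    · filter_upwards with z
      have := sub_smul_dslope f a z
      rw [h0, sub_zero, smul_eq_mul] at this
      exact this.symm
  obtain ⟨g, hg, hfg⟩ := hord
  have hga : g a = d := by
    have h1 : HasDerivAt (fun z => (z - a) * g z) (1 * g a + (a - a) * deriv g a) a :=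
      ((hasDerivAt_id a).sub_const a).mul hg.differentiableAt.hasDerivAt
    have h2 := (h1.congr_of_eventuallyEq hfg).unique hd
    simpa using h2
  refine ⟨fun z => 1 / g z, analyticAt_const.div hg (by rwa [hga]), by simp [hga], ?_⟩
  filter_upwards [nhdsWithin_le_nhds hfg] with z hz
  rw [hz, one_div, mul_inv, one_div]

theorem exists_simplePole_inv_one_sub_cpow_neg (hq : 1 < q) :
    ∃ e : ℂ → ℂ, AnalyticAt ℂ e 0 ∧ e 0 = 1 / (Real.log q : ℂ) ∧
      ∀ᶠ z in 𝓝[≠] (0 : ℂ), 1 / (1 - (q : ℂ) ^ (-z)) = z⁻¹ * e z := by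
  have := exists_simplePole_of_simpleZero
    (analyticAt_const.sub (analyticAt_natCast_cpow_neg hq 0)) (by simp)
    (hasDerivAt_one_sub_cpow_neg hq)
    (by exact_mod_cast (Real.log_pos (by exact_mod_cast hq)).ne')
  simpa using this

end QPower

/-- A function of the shape of the complete Artin zeta function is zeta-like as soon as its
inverse zeros are at most `q` in absolute value. -/
theorem isZetaLike_of_norm_le {q : ℕ} (hq : 1 < q) (c : ℂ) {n : ℕ} {ω : Fin n → ℂ}
    (hω : ∀ i, ‖ω i‖ ≤ q) :
    IsZetaLike fun s => (q : ℂ) ^ (c * s) *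
      ((∏ i, (1 - ω i * (q : ℂ) ^ (-s))) /
        ((1 - (q : ℂ) ^ (-s)) * (1 - (q : ℂ) * (q : ℂ) ^ (-s)))) := by
  have hq0 : (q : ℂ) ≠ 0 := by exact_mod_cast (by omega : q ≠ 0)
  have hlead (s : ℂ) : AnalyticAt ℂ (fun z : ℂ => (q : ℂ) ^ (c * z)) s := by
    have : (fun z : ℂ => (q : ℂ) ^ (c * z)) = fun z => Complex.exp (Complex.log q * (c * z)) := by
      funext z
      rw [Complex.cpow_def_of_ne_zero hq0]
    rw [this]
    fun_prop
  have hnum (s : ℂ) : AnalyticAt ℂ (fun z : ℂ => ∏ i, (1 - ω i * (q : ℂ) ^ (-z))) s := by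
    refine Finset.analyticAt_fun_prod _ fun i _ => ?_
    exact analyticAt_const.sub (analyticAt_const.mul (analyticAt_natCast_cpow_neg hq s))
  have hden1 (s : ℂ) : AnalyticAt ℂ (fun z : ℂ => 1 - (q : ℂ) ^ (-z)) s :=
    analyticAt_const.sub (analyticAt_natCast_cpow_neg hq s)
  have hden2 (s : ℂ) : AnalyticAt ℂ (fun z : ℂ => 1 - (q : ℂ) * (q : ℂ) ^ (-z)) s :=
    analyticAt_const.sub (analyticAt_const.mul (analyticAt_natCast_cpow_neg hq s))
  have main (s : ℂ) (h1 : ∀ i, 1 - ω i * (q : ℂ) ^ (-s) ≠ 0) (h2 : 1 - (q : ℂ) ^ (-s) ≠ 0)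
      (h3 : 1 - (q : ℂ) * (q : ℂ) ^ (-s) ≠ 0) :
      AnalyticAt ℂ (fun s => (q : ℂ) ^ (c * s) * ((∏ i, (1 - ω i * (q : ℂ) ^ (-s))) /
        ((1 - (q : ℂ) ^ (-s)) * (1 - (q : ℂ) * (q : ℂ) ^ (-s))))) s ∧
      (q : ℂ) ^ (c * s) * ((∏ i, (1 - ω i * (q : ℂ) ^ (-s))) /
        ((1 - (q : ℂ) ^ (-s)) * (1 - (q : ℂ) * (q : ℂ) ^ (-s)))) ≠ 0 := by
    refine ⟨(hlead s).mul ((hnum s).div ((hden1 s).mul (hden2 s)) (mul_ne_zero h2 h3)), ?_⟩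
    refine mul_ne_zero ?_ (div_ne_zero (Finset.prod_ne_zero_iff.2 fun i _ => h1 i)
      (mul_ne_zero h2 h3))
    rw [Ne, Complex.cpow_eq_zero_iff]
    exact fun h => hq0 h.1
  refine ⟨?_, ?_, ?_⟩
  · have h1 : ∀ᶠ s in Filter.codiscrete ℂ, ∀ i, 1 - ω i * (q : ℂ) ^ (-s) ≠ 0 :=
      Filter.eventually_all.2 fun i => eventually_one_sub_mul_cpow_neg_ne_zero hq (ω i)
    filter_upwards [h1, eventually_one_sub_mul_cpow_neg_ne_zero hq 1,
      eventually_one_sub_mul_cpow_neg_ne_zero hq q] with s h1 h2 h3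
    exact main s h1 (by simpa using h2) h3
  · intro m hm
    have hcp : (q : ℂ) ^ (-(m : ℂ)) = ((q : ℂ) ^ m)⁻¹ := by
      rw [Complex.cpow_neg, Complex.cpow_natCast]
    have hlt : (q : ℝ) < (q : ℝ) ^ m := by
      simpa using pow_lt_pow_right₀ (by exact_mod_cast hq : (1 : ℝ) < q) (by omega : 1 < m)
    -- A zero would mean a = q^m, of norm greater than q because m ≥ 2. The cases a = ω_i, 1 and q
    -- cover all factors of numerator and denominator.
    have hne (a : ℂ) (ha : ‖a‖ ≤ q) : 1 - a * (q : ℂ) ^ (-(m : ℂ)) ≠ 0 := by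
      rw [hcp, sub_ne_zero]
      intro h
      have h' : a = (q : ℂ) ^ m := by
        have := (eq_mul_inv_iff_mul_eq₀ (pow_ne_zero m hq0)).1 h
        simpa using this.symm
      rw [h', norm_pow, Complex.norm_natCast] at ha
      linarith
    refine main m (fun i => hne _ (hω i)) ?_ (hne q (by simp))
    simpa using hne 1 (by simpa using (by exact_mod_cast hq.le : (1 : ℝ) ≤ q))
  · have h10 : (1 : ℂ) - (q : ℂ) * (q : ℂ) ^ (-(1 : ℂ)) = 0 := by
      rw [Complex.cpow_neg, Complex.cpow_one, mul_inv_cancel₀ hq0, sub_self]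
    have hder : HasDerivAt (fun z : ℂ => 1 - (q : ℂ) * (q : ℂ) ^ (-z)) (Complex.log q) 1 := by
      have h1 : HasDerivAt (fun z : ℂ => (q : ℂ) ^ (-z))
          ((q : ℂ) ^ (-(1 : ℂ)) * Complex.log q * -1) 1 :=
        (hasDerivAt_neg' (1 : ℂ)).const_cpow (Or.inl hq0)
      refine ((h1.const_mul (q : ℂ)).const_sub 1).congr_deriv ?_
      rw [Complex.cpow_neg, Complex.cpow_one]
      field_simp
    have hlog : Complex.log q ≠ 0 := by
      rw [← Complex.ofReal_natCast, ← Complex.ofReal_log (Nat.cast_nonneg q)]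
      exact_mod_cast (Real.log_pos (by exact_mod_cast hq)).ne'
    obtain ⟨e, he, -, hev⟩ := exists_simplePole_of_simpleZero (hden2 1) h10 hder hlog
    refine ⟨fun s => (q : ℂ) ^ (c * s) * ((∏ i, (1 - ω i * (q : ℂ) ^ (-s))) /
      (1 - (q : ℂ) ^ (-s)) * e s), ?_, ?_⟩
    · refine (hlead 1).mul (((hnum 1).div (hden1 1) ?_).mul he)
      have := natCast_cpow_neg_intCast_ne_one hq (m := 1) one_ne_zero
      rw [sub_ne_zero]
      simpa using this.symm
    · filter_upwards [hev] with s hs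
      rw [← div_div, div_eq_mul_one_div _ (1 - (q : ℂ) * (q : ℂ) ^ (-s)), hs]
      ring

/-! ### Heights of coroots -/

namespace RootPairing

theorem toLinearMap_weylGroup_smul_coroot {ι R M N : Type*} [CommRing R] [AddCommGroup M]
    [Module R M] [AddCommGroup N] [Module R N] (P : RootPairing ι R M N) (w : P.weylGroup)
    (x : M) (i : ι) :
    P.toLinearMap (w • x) (P.coroot i) =
      P.toLinearMap x (P.coroot ((P.weylGroupToPerm w).symm i)) := by
  have h := Hom.weight_coweight_transpose_apply P P (P.coroot i) (w : Aut P).toHom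
  rw [Hom.coroot_coweightMap_apply] at h
  exact LinearMap.congr_fun h x

/-- The roots span, so an element is determined by its action on them. This makes the Weyl group
finite, so that the period is a genuine finite sum. -/
theorem weylGroupToPerm_injective {ι R M N : Type*} [CommRing R] [AddCommGroup M]
    [Module R M] [AddCommGroup N] [Module R N] (P : RootPairing ι R M N) [P.IsRootSystem] :
    Function.Injective P.weylGroupToPerm := by
  intro v w h
  apply Subtype.ext
  apply Equiv.weightHom_injective P
  apply LinearEquiv.toLinearMap_injective
  refine LinearMap.ext_on_range (v := P.root) IsRootSystem.span_root_eq_top fun i => ?_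
  have h1 := P.weylGroup_apply_root v i
  have h2 := P.weylGroup_apply_root w i
  rw [h, ← h2] at h1
  exact h1

instance finite_weylGroup {ι R M N : Type*} [Finite ι] [CommRing R] [AddCommGroup M]
    [Module R M] [AddCommGroup N] [Module R N] (P : RootPairing ι R M N) [P.IsRootSystem] :
    Finite P.weylGroup :=
  Finite.of_injective _ P.weylGroupToPerm_injective

namespace Base

section Positivity

variable {ι R M N : Type*} [Finite ι] [Field R] [CharZero R] [AddCommGroup M]
  [Module R M] [AddCommGroup N] [Module R N] {P : RootPairing ι R M N} [P.IsCrystallographic]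
  [P.IsReduced] {b : P.Base}

/-- Induction on height. A positive non-simple root pairs positively with some simple α_j, so s_j
lowers its height and keeps it positive. The same permutation describes s_j on coroots, where it
preserves positivity away from α_j, so positivity is transported back. -/
theorem IsPos.flip {i : ι} (hi : b.IsPos i) : b.flip.IsPos i := by
  induction hn : (b.height i).toNat using Nat.strong_induction_on generalizing i with
  | _ n ih =>
    by_cases his : i ∈ b.support
    · exact isPos_of_mem_support (b := b.flip) his
    · obtain ⟨j, hj, hji⟩ := hi.exists_mem_support_pos_pairingIn
      rw [P.zero_lt_pairingIn_iff'] at hji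
      have hij : i ≠ j := by
        rintro rfl
        exact his hj
      have hpos : b.IsPos (P.reflectionPerm j i) := hi.reflectionPerm hj hij
      have hroot : P.root (P.reflectionPerm j i) =
          P.root i + (-P.pairingIn ℤ i j) • P.root j := by
        rw [root_reflectionPerm, neg_smul, reflection_apply_root' ℤ, sub_eq_add_neg]
      have hht := b.height_add_zsmul hroot
      rw [height_one_of_mem_support hj, smul_eq_mul, mul_one] at hht
      have hlt : (b.height (P.reflectionPerm j i)).toNat < n := by
        have := b.isPos_iff.1 hpos
        omega
      have hne : P.reflectionPerm j i ≠ j := by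
        intro h
        have h1 := hi
        rw [← P.reflectionPerm_involutive j i, h] at h1
        exact (IsPos.neg_iff_not b j).1 h1 (isPos_of_mem_support hj)
      have := (ih _ hlt hpos rfl).reflectionPerm (b := b.flip) hj hne
      have h' : P.flip.reflectionPerm j (P.reflectionPerm j i) = i :=
        P.reflectionPerm_involutive j i
      rwa [h'] at this

theorem IsPos.exists_coroot_eq_sum_nat {i : ι} (hi : b.IsPos i) :
    ∃ f : ι → ℕ, P.coroot i = ∑ j ∈ b.support, f j • P.coroot j := by
  obtain ⟨f, -, hf⟩ := b.flip.exists_root_eq_sum_nat_or_neg i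
  rcases hf with hf | hf
  · exact ⟨f, hf⟩
  · exfalso
    have h1 : P.flip.root i = ∑ j ∈ b.flip.support, (-(f j : ℤ)) • P.flip.root j := by
      rw [hf]
      simp
    have h2 := height_eq_sum h1
    have h3 := b.flip.isPos_iff.1 hi.flip
    rw [h2, Finset.sum_neg_distrib] at h3
    have : 0 ≤ ∑ j ∈ b.flip.support, (f j : ℤ) := Finset.sum_nonneg fun _ _ => by positivity
    omega

end Positivity

section Coordinates

open scoped Classical

variable {ι M N : Type*} [AddCommGroup M] [Module ℂ M] [AddCommGroup N] [Module ℂ N]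
  {P : RootPairing ι ℂ M N} [P.IsRootSystem] {b : P.Base}

theorem corootCoeff_apply_coe (p j : b.support) :
    b.corootCoeff p j = if j = p then 1 else 0 := by
  have h : P.toLinearMap (b.fundamentalWeight p) = b.toCoweightBasis.coord p :=
    LinearEquiv.apply_symm_apply P.toLinearMap.toPerfPair _
  rw [corootCoeff, h, Module.Basis.coord_apply, toCoweightBasis_repr_coroot,
    Finsupp.single_apply]

variable [Fintype ι]

theorem toLinearMap_weightOfCoord_coroot (t : b.support → ℂ) (i : ι) :
    P.toLinearMap (b.weightOfCoord t) (P.coroot i) =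
      b.corootHeight i + ∑ j, t j * b.corootCoeff j i := by
  simp [weightOfCoord, corootHeight, corootCoeff, map_sum, LinearMap.sum_apply]

end Coordinates

section Complex

open scoped Classical

variable {ι M N : Type*} [Fintype ι] [AddCommGroup M] [Module ℂ M] [AddCommGroup N] [Module ℂ N]
  {P : RootPairing ι ℂ M N} [P.IsCrystallographic] [P.IsReduced] {b : P.Base}

/-- The reflection s_j permutes the positive roots other than α_j and negates their pairings with
α_j^∨. These cancel, and only ⟨α_j, α_j^∨⟩ = 2 survives in 2⟨ρ, α_j^∨⟩. -/
theorem corootHeight_of_mem_support {j : ι} (hj : j ∈ b.support) : b.corootHeight j = 1 := by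
  have hsum : ∑ i with b.IsPos i, P.pairing i j = 2 := by
    have hjmem : j ∈ Finset.univ.filter b.IsPos := by simpa using isPos_of_mem_support hj
    rw [← Finset.add_sum_erase _ _ hjmem, P.pairing_same]
    have hS : ∑ i ∈ (Finset.univ.filter b.IsPos).erase j, P.pairing i j =
        ∑ i ∈ (Finset.univ.filter b.IsPos).erase j, -P.pairing i j := by
      refine Finset.sum_bij' (fun i _ => P.reflectionPerm j i) (fun i _ => P.reflectionPerm j i)
        ?_ ?_ ?_ ?_ ?_
      all_goals
        intro i hi
        simp only [Finset.mem_erase, Finset.mem_filter, Finset.mem_univ, true_and] at hi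
      · simp only [Finset.mem_erase, Finset.mem_filter, Finset.mem_univ, true_and]
        refine ⟨fun h => ?_, hi.2.reflectionPerm hj hi.1⟩
        have h1 := hi.2
        rw [← P.reflectionPerm_involutive j i, h] at h1
        exact (IsPos.neg_iff_not b j).1 h1 (isPos_of_mem_support hj)
      · simp only [Finset.mem_erase, Finset.mem_filter, Finset.mem_univ, true_and]
        refine ⟨fun h => ?_, hi.2.reflectionPerm hj hi.1⟩
        have h1 := hi.2
        rw [← P.reflectionPerm_involutive j i, h] at h1
        exact (IsPos.neg_iff_not b j).1 h1 (isPos_of_mem_support hj)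
      · exact P.reflectionPerm_involutive j i
      · exact P.reflectionPerm_involutive j i
      · rw [← pairing_reflectionPerm, pairing_reflectionPerm_self_right, neg_neg]
    rw [Finset.sum_neg_distrib] at hS
    have : ∑ i ∈ (Finset.univ.filter b.IsPos).erase j, P.pairing i j = 0 := by
      linear_combination hS / 2
    rw [this, add_zero]
  have hexp : b.corootHeight j = 2⁻¹ * ∑ i with b.IsPos i, P.pairing i j := by
    simp [corootHeight, weylVector, map_sum, LinearMap.sum_apply]
  rw [hexp, hsum]
  norm_num

theorem corootHeight_eq_sum {i : ι} {f : ι → ℕ}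
    (hf : P.coroot i = ∑ j ∈ b.support, f j • P.coroot j) :
    b.corootHeight i = ((∑ j ∈ b.support, f j : ℕ) : ℂ) := by
  have h (j : ι) (hj : j ∈ b.support) : P.toLinearMap b.weylVector (P.coroot j) = 1 :=
    corootHeight_of_mem_support hj
  simp only [corootHeight, hf, map_sum, map_nsmul, nsmul_eq_mul]
  rw [Finset.sum_congr rfl fun j hj => by rw [h j hj, mul_one]]
  push_cast
  rfl

/-- The height is the sum of the nonnegative coefficients of the coroot over simple coroots; sum 1
leaves a single simple coroot. This is what confines the poles to simple roots. -/
theorem IsPos.exists_corootHeight {i : ι} (hi : b.IsPos i) :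
    ∃ h : ℕ, 1 ≤ h ∧ b.corootHeight i = h ∧ (h = 1 → i ∈ b.support) := by
  obtain ⟨f, hf⟩ := hi.exists_coroot_eq_sum_nat
  refine ⟨_, ?_, corootHeight_eq_sum hf, fun h1 => ?_⟩
  · by_contra! hlt
    have h0 : ∀ j ∈ b.support, f j = 0 := by simpa using hlt
    refine P.flip.ne_zero i ?_
    change P.coroot i = 0
    rw [hf]
    exact Finset.sum_eq_zero fun j hj => by rw [h0 j hj, zero_smul]
  · obtain ⟨j, hj, hj1, hj2⟩ : ∃ j ∈ b.support, f j = 1 ∧ ∀ k ∈ b.support, k ≠ j → f k = 0 := by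
      obtain ⟨j, hj, hj0⟩ := Finset.exists_ne_zero_of_sum_ne_zero (h1.trans_ne one_ne_zero)
      have hadd := Finset.add_sum_erase b.support f hj
      refine ⟨j, hj, by omega, fun k hk hkj => ?_⟩
      have hle := Finset.single_le_sum (f := f) (fun _ _ => Nat.zero_le _)
        (Finset.mem_erase.2 ⟨hkj, hk⟩)
      omega
    have : P.coroot i = P.coroot j := by
      rw [hf, Finset.sum_eq_single_of_mem j hj fun k hk hkj => by rw [hj2 k hk hkj, zero_smul],
        hj1, one_smul]
    rwa [P.coroot.injective this]

theorem corootHeight_of_not_isPos {i : ι} (hi : ¬ b.IsPos i) :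
    ∃ h : ℕ, 1 ≤ h ∧ b.corootHeight i = -(h : ℂ) := by
  obtain ⟨h, h1, h2, -⟩ := ((IsPos.neg_iff_not b i).2 hi).exists_corootHeight
  refine ⟨h, h1, ?_⟩
  rw [← h2]
  let := P.indexNeg
  simp [corootHeight]

theorem exists_corootHeight_eq_intCast (b : P.Base) (i : ι) :
    ∃ h : ℤ, b.corootHeight i = h ∧ (h = 1 → i ∈ b.support) ∧ (b.IsPos i ↔ 1 ≤ h) := by
  by_cases hi : b.IsPos i
  · obtain ⟨h, h1, h2, h3⟩ := hi.exists_corootHeight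
    exact ⟨h, by simpa using h2, fun h4 => h3 (by exact_mod_cast h4), by simp [hi]; omega⟩
  · obtain ⟨h, h1, h2⟩ := corootHeight_of_not_isPos hi
    refine ⟨-h, by simpa using h2, fun h4 => ?_, ?_⟩
    · omega
    · simp only [hi, false_iff]
      omega

variable [P.IsRootSystem]

theorem IsPos.exists_corootCoeff {i : ι} (hi : b.IsPos i) (p : b.support) :
    ∃ a : ℕ, b.corootCoeff p i = a := by
  obtain ⟨f, hf⟩ := hi.exists_coroot_eq_sum_nat
  refine ⟨f p, ?_⟩
  have h (j : ι) (hj : j ∈ b.support) :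
      P.toLinearMap (b.fundamentalWeight p) (P.coroot j) = if j = p then 1 else 0 := by
    have := corootCoeff_apply_coe p ⟨j, hj⟩
    simpa [corootCoeff, Subtype.ext_iff] using this
  simp only [corootCoeff, hf, map_sum, map_nsmul, nsmul_eq_mul]
  rw [Finset.sum_congr rfl fun j hj => by rw [h j hj]]
  simp

end Complex

end Base

end RootPairing

/-! ### The minimal family of normalizing zeta factors -/

namespace RootPairing.Base

open scoped Classical

theorem one_mem_specialWeyl {ι M N : Type*} [AddCommGroup M] [Module ℂ M] [AddCommGroup N]
    [Module ℂ N] {P : RootPairing ι ℂ M N} (b : P.Base) (p : b.support) :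
    (1 : P.weylGroup) ∈ b.specialWeyl p := by
  intro j hj
  left
  rw [map_one]
  exact Finset.mem_of_mem_erase hj

variable {ι M N : Type*} [Fintype ι] [AddCommGroup M] [Module ℂ M] [AddCommGroup N] [Module ℂ N]
  {P : RootPairing ι ℂ M N} [P.IsRootSystem] (b : P.Base) (p : b.support)

/-- The least multiset of zeta factors that clears all denominators. -/
noncomputable def leastFactors : Multiset (ℂ × ℂ) :=
  (Set.toFinite (b.specialWeyl p)).toFinset.sup fun w =>
    b.zetaDenominator p w - b.zetaNumerator p w

/-- Truncated subtraction is adjoint to addition of multisets, so each condition on m is a lower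
bound, and together they amount to the supremum of these bounds. -/
theorem clearsDenominators_iff {m : Multiset (ℂ × ℂ)} :
    b.ClearsDenominators p m ↔ b.leastFactors p ≤ m := by
  simp [ClearsDenominators, leastFactors, Finset.sup_le_iff, tsub_le_iff_right]

theorem isMinimalNormalization_iff {m : Multiset (ℂ × ℂ)} :
    b.IsMinimalNormalization p m ↔ m = b.leastFactors p := by
  constructor
  · rintro ⟨h1, h2⟩
    exact (Multiset.eq_of_le_of_card_le ((b.clearsDenominators_iff p).1 h1)
      (h2 _ ((b.clearsDenominators_iff p).2 le_rfl))).symm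
  · rintro rfl
    exact ⟨(b.clearsDenominators_iff p).2 le_rfl, fun m' hm' =>
      Multiset.card_le_card ((b.clearsDenominators_iff p).1 hm')⟩

theorem existsUnique_isMinimalNormalization : ∃! m, b.IsMinimalNormalization p m :=
  ⟨b.leastFactors p, (b.isMinimalNormalization_iff p).2 rfl, fun _ h =>
    (b.isMinimalNormalization_iff p).1 h⟩

theorem minimalFactors_eq : b.minimalFactors p = b.leastFactors p :=
  (b.isMinimalNormalization_iff p).1
    (Classical.epsilon_spec (b.existsUnique_isMinimalNormalization p).exists)

variable [P.IsCrystallographic] [P.IsReduced]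

variable {b p} in
theorem mem_leastFactors {x : ℂ × ℂ} (hx : x ∈ b.leastFactors p) :
    ∃ a c : ℕ, 2 ≤ c ∧ x = ((a : ℂ), (c : ℂ)) := by
  rw [← Multiset.count_pos, leastFactors, Multiset.count_finset_sup, Finset.lt_sup_iff] at hx
  obtain ⟨w, -, hx⟩ := hx
  rw [Multiset.count_pos] at hx
  obtain ⟨i, hi, rfl⟩ := Multiset.mem_map.1 (Multiset.mem_of_le (Multiset.sub_le_self _ _) hx)
  have hpos : b.IsPos i := by
    have : i ∈ b.inversionSet w := hi
    simp only [inversionSet, Finset.mem_filter] at this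
    exact this.2.1
  obtain ⟨a, ha⟩ := hpos.exists_corootCoeff p
  obtain ⟨h, h1, h2, -⟩ := hpos.exists_corootHeight
  exact ⟨a, h + 1, by omega, by simp [ha, h2]⟩

/-- The shift to c - 1 undoes the +1 in the denominator. Since c - 1 ≥ 1, positivity of the root,
required in Φ_w but not in `countN`, is automatic. -/
theorem count_zetaDenominator (w : P.weylGroup) {a c : ℕ} (hc : 2 ≤ c) :
    (b.zetaDenominator p w).count ((a : ℂ), (c : ℂ)) = b.countN p w a (c - 1) := by
  rw [zetaDenominator, Multiset.count_map, countN, Finset.card_def, ← Finset.filter_val]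
  congr 2
  ext i
  simp only [inversionSet, Finset.mem_filter, Finset.mem_univ, true_and, Prod.mk.injEq]
  constructor
  · rintro ⟨⟨-, h1⟩, h2, h3⟩
    refine ⟨h1, by simpa using h2.symm, ?_⟩
    push_cast
    linear_combination -h3
  · rintro ⟨h1, h2, h3⟩
    refine ⟨⟨?_, h1⟩, by simpa using h2.symm, ?_⟩
    · obtain ⟨h, h4, -, h5⟩ := b.exists_corootHeight_eq_intCast i
      have : h = (c : ℤ) - 1 := by exact_mod_cast h4.symm.trans h3
      rw [h5]
      omega
    · push_cast at h3
      linear_combination -h3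

/-- Discarding Δ_p does not change the count, because simple coroots have height 1 < c. -/
theorem count_zetaNumerator (w : P.weylGroup) {a c : ℕ} (hc : 2 ≤ c) :
    (b.zetaNumerator p w).count ((a : ℂ), (c : ℂ)) = b.countN p w a c := by
  rw [zetaNumerator, Multiset.count_map, countN, Finset.card_def, ← Finset.filter_val]
  congr 2
  ext i
  simp only [inversionSet, leviBase, Finset.mem_filter, Finset.mem_sdiff, Finset.mem_univ,
    true_and, Prod.mk.injEq]
  constructor
  · rintro ⟨⟨⟨-, h1⟩, -⟩, h2, h3⟩
    exact ⟨h1, by simpa using h2.symm, by simpa using h3.symm⟩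
  · rintro ⟨h1, h2, h3⟩
    refine ⟨⟨⟨?_, h1⟩, fun hi => ?_⟩, by simpa using h2.symm, by simpa using h3.symm⟩
    · obtain ⟨h, h4, -, h5⟩ := b.exists_corootHeight_eq_intCast i
      have : h = (c : ℤ) := by exact_mod_cast h4.symm.trans h3
      rw [h5]
      omega
    · rw [corootHeight_of_mem_support (Finset.mem_of_mem_erase hi)] at h3
      have : (1 : ℤ) = c := by exact_mod_cast h3
      omega

theorem countN_one_of_pos (k : ℤ) {h : ℤ} (hh : 1 ≤ h) : b.countN p 1 k h = 0 := by
  rw [countN, Finset.card_eq_zero, Finset.filter_eq_empty_iff]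
  rintro i - ⟨h1, -, h3⟩
  obtain ⟨h', h4, -, h5⟩ := b.exists_corootHeight_eq_intCast i
  have : h' = h := by exact_mod_cast h4.symm.trans h3
  rw [map_one, Equiv.Perm.one_apply, h5] at h1
  omega

theorem count_leastFactors (a : ℕ) {c : ℕ} (hc : 2 ≤ c) :
    ((b.leastFactors p).count ((a : ℂ), (c : ℂ)) : ℤ) = b.countM p a c := by
  have hcount : (b.leastFactors p).count ((a : ℂ), (c : ℂ)) =
      (Set.toFinite (b.specialWeyl p)).toFinset.sup fun w =>
        b.countN p w a (c - 1) - b.countN p w a c := by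
    rw [leastFactors, Multiset.count_finset_sup]
    refine Finset.sup_congr rfl fun w _ => ?_
    rw [Multiset.count_sub, b.count_zetaDenominator p w hc, b.count_zetaNumerator p w hc]
  have hbdd : BddAbove (Set.range fun w : b.specialWeyl p =>
      ((b.countN p w a ((c : ℤ) - 1) : ℤ) - b.countN p w a c)) := (Set.finite_range _).bddAbove
  -- The identity contributes 0, so the integer maximum is nonnegative and agrees with the maximum
  -- of the truncated differences.
  have hone := le_ciSup hbdd ⟨1, b.one_mem_specialWeyl p⟩
  simp only [b.countN_one_of_pos p a (h := (c : ℤ) - 1) (by omega),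
    b.countN_one_of_pos p a (h := (c : ℤ)) (by omega), Nat.cast_zero, sub_zero] at hone
  have : Nonempty (b.specialWeyl p) := ⟨⟨1, b.one_mem_specialWeyl p⟩⟩
  rw [hcount, countM]
  apply le_antisymm
  · rw [← Int.le_toNat hone]
    refine Finset.sup_le fun w hw => ?_
    have := le_ciSup hbdd ⟨w, by simpa using hw⟩
    simp only at this
    omega
  · refine ciSup_le fun w => ?_
    have := Finset.le_sup (s := (Set.toFinite (b.specialWeyl p)).toFinset)
      (f := fun w => b.countN p w a (c - 1) - b.countN p w a c) (b := (w : P.weylGroup))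
      (by simp)
    omega

/-- A product over a multiset of zeta factors with natural parameters, as a double product. -/
theorem zetaProduct_eq_finprod {Z : ℂ → ℂ} {m : Multiset (ℂ × ℂ)} {e : ℕ → ℕ → ℤ}
    (hm : ∀ x ∈ m, ∃ a c : ℕ, 2 ≤ c ∧ x = ((a : ℂ), (c : ℂ)))
    (he : ∀ a c : ℕ, 2 ≤ c → (m.count ((a : ℂ), (c : ℂ)) : ℤ) = e a c) (s : ℂ) :
    zetaProduct Z m s = ∏ᶠ (a : ℕ) (c : ℕ) (_ : 2 ≤ c), Z (a * s + c) ^ e a c := by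
  let F : ℕ × ℕ → ℂ := fun y => ∏ᶠ (_ : 2 ≤ y.2), Z (y.1 * s + y.2) ^ e y.1 y.2
  have hinj : Function.Injective (fun y : ℕ × ℕ => ((y.1 : ℂ), (y.2 : ℂ))) := by
    rintro ⟨a, c⟩ ⟨a₂, c₂⟩ h
    simpa using h
  -- The exponent is the multiplicity in m, so F is 1 off the finite set of members of m; this
  -- allows the nested products to be merged into one over pairs.
  have hF (y : ℕ × ℕ) : F y = if ((y.1 : ℂ), (y.2 : ℂ)) ∈ m then
      Z (y.1 * s + y.2) ^ m.count ((y.1 : ℂ), (y.2 : ℂ)) else 1 := by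
    simp only [F]
    by_cases hy : 2 ≤ y.2
    · rw [finprod_eq_if, if_pos hy, ← he _ _ hy, zpow_natCast]
      split_ifs with h
      · rfl
      · rw [Multiset.count_eq_zero_of_notMem h, pow_zero]
    · rw [finprod_eq_if, if_neg hy, if_neg]
      intro hmem
      obtain ⟨a, c, hc, h⟩ := hm _ hmem
      have : y = (a, c) := hinj h
      exact hy (by simp [this, hc])
  let T : Finset (ℕ × ℕ) := m.toFinset.preimage _ hinj.injOn
  have hsub : Function.mulSupport F ⊆ T := by
    intro y hy
    by_contra hyT
    refine hy ?_
    rw [hF, if_neg]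
    simpa [T] using hyT
  have h1 : (∏ᶠ (a : ℕ) (c : ℕ) (_ : 2 ≤ c), Z (a * s + c) ^ e a c) = ∏ᶠ y, F y :=
    (finprod_curry F (T.finite_toSet.subset hsub)).symm
  rw [h1, finprod_eq_prod_of_mulSupport_subset F hsub, zetaProduct,
    Finset.prod_multiset_map_count]
  symm
  refine Finset.prod_bij (fun y _ => ((y.1 : ℂ), (y.2 : ℂ))) ?_ ?_ ?_ ?_
  · intro y hy
    simpa [T] using hy
  · intro y _ y' _ h
    exact hinj h
  · intro x hx
    obtain ⟨a, c, hc, rfl⟩ := hm x (by simpa using hx)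
    exact ⟨(a, c), by simpa [T] using hx, rfl⟩
  · intro y hy
    rw [hF, if_pos (by simpa [T] using hy)]

end RootPairing.Base

/-! ### Residues of the summands of the period -/

namespace RootPairing.Base

open scoped Classical

theorem mem_leviBase_of_mem_support {ι M N : Type*} [AddCommGroup M] [Module ℂ M]
    [AddCommGroup N] [Module ℂ N] {P : RootPairing ι ℂ M N} [P.IsRootSystem] (b : P.Base)
    {p : b.support} {i : ι} (hi : i ∈ b.support)
    (h0 : b.corootCoeff p i = 0) : i ∈ b.leviBase p := by
  refine Finset.mem_erase.2 ⟨?_, hi⟩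
  rintro rfl
  rw [corootCoeff_apply_coe] at h0
  simp at h0

section

variable {ι M N : Type*} [Fintype ι] [AddCommGroup M] [Module ℂ M] [AddCommGroup N] [Module ℂ N]
  {P : RootPairing ι ℂ M N} (b : P.Base)

/-- `w⁻¹Δ`, as a set of indices. -/
noncomputable def preimageBase (w : P.weylGroup) : Finset ι :=
  {i | P.weylGroupToPerm w i ∈ b.support}

/-- Hence a root of Δ_p gives a pole in at most one of the two products, and the pole stays simple.
-/
theorem disjoint_preimageBase_inversionSet [P.IsCrystallographic] [P.IsReduced]
    (w : P.weylGroup) : Disjoint (b.preimageBase w) (b.inversionSet w) := by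
  rw [Finset.disjoint_left]
  intro i h1 h2
  simp only [preimageBase, inversionSet, Finset.mem_filter, Finset.mem_univ, true_and] at h1 h2
  exact h2.2 (isPos_of_mem_support h1)

theorem leviBase_sdiff_eq_empty_iff (p : b.support) (w : P.weylGroup) :
    b.leviBase p \ (b.preimageBase w ∪ b.inversionSet w) = ∅ ↔ w ∈ b.specialWeyl p := by
  rw [Finset.sdiff_eq_empty_iff_subset]
  refine forall₂_congr fun j hj => ?_
  have : b.IsPos j := isPos_of_mem_support (Finset.mem_of_mem_erase hj)
  simp [preimageBase, inversionSet, this]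

variable [P.IsRootSystem]

/-- `⟨λ, α^∨⟩` for `λ = ρ + ∑ t_j λ_j`, as an affine function of `t`. -/
noncomputable def corootValue (i : ι) (t : b.support → ℂ) : ℂ :=
  b.corootHeight i + ∑ j, t j * b.corootCoeff j i

theorem analyticAt_corootValue (i : ι) (t : b.support → ℂ) :
    AnalyticAt ℂ (b.corootValue i) t := by
  refine analyticAt_const.add (Finset.analyticAt_fun_sum _ fun j _ => ?_)
  exact ((ContinuousLinearMap.proj (R := ℂ) (φ := fun _ : b.support => ℂ) j).analyticAt t).mul
    analyticAt_const

theorem corootValue_single (p : b.support) (i : ι) (s : ℂ) :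
    b.corootValue i (Pi.single p s) = b.corootCoeff p i * s + b.corootHeight i := by
  rw [corootValue, Finset.sum_eq_single p]
  · rw [Pi.single_eq_same]
    ring
  · intro j _ hj
    rw [Pi.single_eq_of_ne hj, zero_mul]
  · simp

/-- Substitute wα for the simple root: the pairing is Weyl invariant, and the ρ in the exponent
contributes the height 1 of a simple coroot. -/
theorem prod_inv_one_sub_eq_prod_preimageBase [P.IsCrystallographic] [P.IsReduced] (q : ℕ)
    (w : P.weylGroup) (t : b.support → ℂ) :
    (∏ i ∈ b.support, 1 / (1 - (q : ℂ) ^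
      (-(P.toLinearMap (w • b.weightOfCoord t - b.weylVector) (P.coroot i))))) =
    ∏ i ∈ b.preimageBase w, 1 / (1 - (q : ℂ) ^ (-(b.corootValue i t - 1))) := by
  symm
  refine Finset.prod_bij (fun i _ => P.weylGroupToPerm w i) ?_ ?_ ?_ ?_
  · intro i hi
    simpa [preimageBase] using hi
  · intro i _ j _ h
    exact (P.weylGroupToPerm w).injective h
  · intro i hi
    exact ⟨(P.weylGroupToPerm w).symm i, by simpa [preimageBase] using hi, by simp⟩
  · intro i hi
    have h1 : P.toLinearMap b.weylVector (P.coroot (P.weylGroupToPerm w i)) = 1 :=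
      corootHeight_of_mem_support (by simpa [preimageBase] using hi)
    rw [map_sub, LinearMap.sub_apply, toLinearMap_weylGroup_smul_coroot, h1,
      Equiv.symm_apply_apply, toLinearMap_weightOfCoord_coroot, corootValue]

theorem periodTerm_weightOfCoord [P.IsCrystallographic] [P.IsReduced] (q : ℕ) (Z : ℂ → ℂ)
    (w : P.weylGroup) (t : b.support → ℂ) :
    b.periodTerm q Z w (b.weightOfCoord t) =
      (∏ i ∈ b.preimageBase w, 1 / (1 - (q : ℂ) ^ (-(b.corootValue i t - 1)))) *
        ∏ i ∈ b.inversionSet w, Z (b.corootValue i t) / Z (b.corootValue i t + 1) := by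
  rw [periodTerm, prod_inv_one_sub_eq_prod_preimageBase]
  simp only [toLinearMap_weightOfCoord_coroot, corootValue]

theorem corootValue_of_mem_leviBase [P.IsCrystallographic] [P.IsReduced] {p : b.support}
    {i : ι} (hi : i ∈ b.leviBase p) (t : b.support → ℂ) :
    b.corootValue i t = 1 + t ⟨i, Finset.mem_of_mem_erase hi⟩ := by
  have h (j : b.support) := corootCoeff_apply_coe j ⟨i, Finset.mem_of_mem_erase hi⟩
  simp only at h
  rw [corootValue, corootHeight_of_mem_support (Finset.mem_of_mem_erase hi)]
  simp [h]

theorem corootValue_single_of_mem_leviBase [P.IsCrystallographic] [P.IsReduced] {p : b.support}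
    {i : ι} (hi : i ∈ b.leviBase p) (s : ℂ) : b.corootValue i (Pi.single p s) = 1 := by
  rw [corootValue_of_mem_leviBase b hi, Pi.single_eq_of_ne, add_zero]
  intro h
  exact (Finset.mem_erase.1 hi).1 (congrArg Subtype.val h)

theorem list_prod_inv_eq_prod_leviBase [P.IsCrystallographic] [P.IsReduced] {p : b.support}
    {l : List b.support} (hl : l.Nodup) (hlp : ∀ j, j ∈ l ↔ j ≠ p) (t : b.support → ℂ) :
    (l.map fun j => (t j)⁻¹).prod = ∏ i ∈ b.leviBase p, (b.corootValue i t - 1)⁻¹ := by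
  rw [← List.prod_toFinset _ hl]
  refine Finset.prod_bij (fun j _ => (j : ι)) ?_ ?_ ?_ ?_
  · intro j hj
    refine Finset.mem_erase.2 ⟨fun h => ?_, j.2⟩
    exact (hlp j).1 (by simpa using hj) (Subtype.ext h)
  · intro i _ j _ h
    exact Subtype.ext h
  · intro i hi
    refine ⟨⟨i, Finset.mem_of_mem_erase hi⟩, ?_, rfl⟩
    rw [List.mem_toFinset, hlp]
    intro h
    exact (Finset.mem_erase.1 hi).1 (congrArg Subtype.val h)
  · intro j hj
    have hmem : (j : ι) ∈ b.leviBase p := by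
      refine Finset.mem_erase.2 ⟨fun h => ?_, j.2⟩
      exact (hlp j).1 (by simpa using hj) (Subtype.ext h)
    rw [corootValue_of_mem_leviBase b hmem]
    simp

/-- For generic `s`, no factor with `⟨λ_p, α^∨⟩ ≠ 0` is singular at `s_p = s`, `s_j = 0`. -/
theorem eventually_generic {p : b.support} {q : ℕ} {Z : ℂ → ℂ} (hq : 1 < q) (hZ : IsZetaLike Z) :
    ∀ᶠ s in Filter.codiscrete ℂ, ∀ i, b.corootCoeff p i ≠ 0 →
      1 - (q : ℂ) ^ (-(b.corootValue i (Pi.single p s) - 1)) ≠ 0 ∧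
      AnalyticAt ℂ Z (b.corootValue i (Pi.single p s)) ∧
      AnalyticAt ℂ Z (b.corootValue i (Pi.single p s) + 1) ∧
      Z (b.corootValue i (Pi.single p s) + 1) ≠ 0 := by
  refine Filter.eventually_all.2 fun i => ?_
  by_cases hi : b.corootCoeff p i = 0
  · simp [hi]
  · filter_upwards [(tendsto_affine_codiscrete hi (b.corootHeight i - 1)).eventually
      (eventually_one_sub_mul_cpow_neg_ne_zero hq 1),
      hZ.eventually_affine hi (b.corootHeight i),
      hZ.eventually_affine hi (b.corootHeight i + 1)] with s h1 h2 h3 _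
    rw [corootValue_single, add_assoc, add_sub_assoc]
    exact ⟨by simpa only [one_mul] using h1, h2.1, h3.1, h3.2⟩

end

/-- Extracts the full polar part over L; every index of L at which no pole occurs is paid for by a
zero v_i. -/
theorem prod_ite_inv_mul_prod_ite_inv {ι : Type*} {L B I : Finset ι} (hBI : Disjoint B I)
    {v : ι → ℂ} (hv : ∀ i ∈ L, v i ≠ 0) :
    (∏ i ∈ B, if i ∈ L then (v i)⁻¹ else 1) * (∏ i ∈ I, if i ∈ L then (v i)⁻¹ else 1) =
      (∏ i ∈ L, (v i)⁻¹) * ∏ i ∈ L \ (B ∪ I), v i := by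
  rw [Finset.prod_ite_mem, Finset.prod_ite_mem, ← Finset.prod_union
    (Finset.disjoint_of_subset_left Finset.inter_subset_left
      (Finset.disjoint_of_subset_right Finset.inter_subset_left hBI)),
    ← Finset.union_inter_distrib_right, Finset.inter_comm,
    ← Finset.prod_inter_mul_prod_sdiff L (B ∪ I) (fun i => (v i)⁻¹), mul_assoc,
    ← Finset.prod_mul_distrib, Finset.prod_eq_one (s := L \ (B ∪ I)), mul_one]
  intro i hi
  exact inv_mul_cancel₀ (hv i (Finset.mem_sdiff.1 hi).1)

variable {ι M N : Type*} [Fintype ι] [AddCommGroup M] [Module ℂ M] [AddCommGroup N] [Module ℂ N]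
  {P : RootPairing ι ℂ M N} [P.IsRootSystem] [P.IsCrystallographic] [P.IsReduced] (b : P.Base)
  {p : b.support} {l : List b.support} {q : ℕ} {Z : ℂ → ℂ}

/-- The polar part is the same product over all j ≠ p for every w, whichever poles really occur.
Thus one H computes both the residue and its vanishing, and the H of different w can be added. -/
theorem exists_regularPart_periodTerm (hq : 1 < q) (hZ : IsZetaLike Z) (hl : l.Nodup)
    (hlp : ∀ j, j ∈ l ↔ j ≠ p) (w : P.weylGroup) :
    ∀ᶠ s in Filter.codiscrete ℂ, ∃ H : (b.support → ℂ) → ℂ, AnalyticAt ℂ H (Pi.single p s) ∧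
      (∀ᶠ t in 𝓝 (Pi.single p s), (∀ j ∈ l, t j ≠ 0) →
        b.periodTerm q Z w (b.weightOfCoord t) = (l.map fun j => (t j)⁻¹).prod * H t) ∧
      H (Pi.single p s) = if w ∈ b.specialWeyl p then b.residueTerm q Z p w s else 0 := by
  obtain ⟨e, he, he0, hepole⟩ := exists_simplePole_inv_one_sub_cpow_neg hq
  obtain ⟨h, hh, hpole⟩ := hZ.pole
  filter_upwards [b.eventually_generic hq hZ] with s hs
  set t₀ : b.support → ℂ := Pi.single p s with ht₀
  have hval {i : ι} (hi : b.corootCoeff p i = 0) : b.corootValue i t₀ = b.corootHeight i := by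
    rw [ht₀, corootValue_single, hi, zero_mul, zero_add]
  have hvL {i : ι} (hi : i ∈ b.leviBase p) : b.corootValue i t₀ = 1 :=
    b.corootValue_single_of_mem_leviBase hi s
  have hv (i : ι) : AnalyticAt ℂ (b.corootValue i) t₀ := b.analyticAt_corootValue i t₀
  have hv1 (i : ι) : AnalyticAt ℂ (fun t => b.corootValue i t - 1) t₀ :=
    (hv i).sub analyticAt_const
  have hE (i : ι) (hi : i ∉ b.leviBase p) :
      AnalyticAt ℂ (fun t => 1 / (1 - (q : ℂ) ^ (-(b.corootValue i t - 1)))) t₀ := by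
    refine (analyticAt_inv_one_sub_cpow_neg hq ?_).fun_comp (hv1 i)
    by_cases hc : b.corootCoeff p i = 0
    · obtain ⟨m, hm, hm1, -⟩ := b.exists_corootHeight_eq_intCast i
      have hne : m - 1 ≠ 0 := fun h0 =>
        hi (b.mem_leviBase_of_mem_support (hm1 (by omega)) hc)
      rw [hval hc, hm, sub_ne_zero]
      have := natCast_cpow_neg_intCast_ne_one hq hne
      push_cast at this
      exact this.symm
    · exact (hs i hc).1
  have hZn (i : ι) (hpos : b.IsPos i) (hi : i ∉ b.leviBase p) :
      AnalyticAt ℂ (fun t => Z (b.corootValue i t)) t₀ := by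
    refine AnalyticAt.fun_comp (g := Z) ?_ (hv i)
    by_cases hc : b.corootCoeff p i = 0
    · obtain ⟨m, hm, hm1, hm2⟩ := hpos.exists_corootHeight
      have hne : m ≠ 1 := fun h0 => hi (b.mem_leviBase_of_mem_support (hm2 h0) hc)
      rw [hval hc, hm1]
      exact (hZ.regular m (by omega)).1
    · exact (hs i hc).2.1
  have hZd (i : ι) (hpos : b.IsPos i) :
      AnalyticAt ℂ Z (b.corootValue i t₀ + 1) ∧ Z (b.corootValue i t₀ + 1) ≠ 0 := by
    by_cases hc : b.corootCoeff p i = 0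
    · obtain ⟨m, hm, hm1, -⟩ := hpos.exists_corootHeight
      rw [hval hc, hm1]
      exact_mod_cast hZ.regular (m + 1) (by omega)
    · exact (hs i hc).2.2
  have hpos {i : ι} (hi : i ∈ b.inversionSet w) : b.IsPos i := by
    simp only [inversionSet, Finset.mem_filter] at hi
    exact hi.2.1
  -- `E'` and `Z'` are the factors with the simple pole at v_α = 1 stripped off when α ∈ Δ_p.
  let E' (i : ι) (t : b.support → ℂ) : ℂ :=
    if i ∈ b.leviBase p then e (b.corootValue i t - 1)
    else 1 / (1 - (q : ℂ) ^ (-(b.corootValue i t - 1)))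
  let Z' (i : ι) (t : b.support → ℂ) : ℂ :=
    if i ∈ b.leviBase p then h (b.corootValue i t) else Z (b.corootValue i t)
  have hE' (i : ι) : AnalyticAt ℂ (E' i) t₀ := by
    simp only [E']
    split_ifs with hi
    · exact he.fun_comp_of_eq (hv1 i) (by rw [hvL hi, sub_self])
    · exact hE i hi
  have hZ' {i : ι} (hi : i ∈ b.inversionSet w) : AnalyticAt ℂ (Z' i) t₀ := by
    simp only [Z']
    split_ifs with hiL
    · exact hh.fun_comp_of_eq (hv i) (hvL hiL)
    · exact hZn i (hpos hi) hiL
  refine ⟨fun t => (∏ i ∈ b.leviBase p \ (b.preimageBase w ∪ b.inversionSet w),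
    (b.corootValue i t - 1)) * ((∏ i ∈ b.preimageBase w, E' i t) *
      ∏ i ∈ b.inversionSet w, Z' i t / Z (b.corootValue i t + 1)), ?_, ?_, ?_⟩
  · refine (Finset.analyticAt_fun_prod _ fun i _ => hv1 i).mul
      ((Finset.analyticAt_fun_prod _ fun i _ => hE' i).mul
        (Finset.analyticAt_fun_prod _ fun i hi => (hZ' hi).div ?_ (hZd i (hpos hi)).2))
    exact AnalyticAt.fun_comp (g := Z) (hZd i (hpos hi)).1 ((hv i).add analyticAt_const)
  · have hev : ∀ᶠ t in 𝓝 t₀, ∀ i ∈ b.leviBase p, b.corootValue i t - 1 ≠ 0 →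
        1 / (1 - (q : ℂ) ^ (-(b.corootValue i t - 1))) =
          (b.corootValue i t - 1)⁻¹ * e (b.corootValue i t - 1) ∧
        Z (b.corootValue i t) = (b.corootValue i t - 1)⁻¹ * h (b.corootValue i t) := by
      refine (Filter.eventually_all_finset _).2 fun i hi => ?_
      have h1 : Filter.Tendsto (fun t => b.corootValue i t - 1) (𝓝 t₀) (𝓝 0) := by
        have := (hv1 i).continuousAt.tendsto
        rwa [hvL hi, sub_self] at this
      have h2 : Filter.Tendsto (b.corootValue i) (𝓝 t₀) (𝓝 1) := by
        have := (hv i).continuousAt.tendsto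
        rwa [hvL hi] at this
      filter_upwards [h1.eventually (eventually_nhdsWithin_iff.1 hepole),
        h2.eventually (eventually_nhdsWithin_iff.1 hpole)] with t ht1 ht2 hne
      exact ⟨ht1 hne, ht2 fun h => hne (by rw [h, sub_self])⟩
    filter_upwards [hev] with t ht hne
    have hneL : ∀ i ∈ b.leviBase p, b.corootValue i t - 1 ≠ 0 := by
      intro i hi
      rw [corootValue_of_mem_leviBase b hi, add_sub_cancel_left]
      refine hne _ ((hlp _).2 fun h => ?_)
      exact (Finset.mem_erase.1 hi).1 (congrArg Subtype.val h)
    have h1 (i : ι) : 1 / (1 - (q : ℂ) ^ (-(b.corootValue i t - 1))) =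
        (if i ∈ b.leviBase p then (b.corootValue i t - 1)⁻¹ else 1) * E' i t := by
      simp only [E']
      split_ifs with hi
      · exact (ht i hi (hneL i hi)).1
      · rw [one_mul]
    have h2 (i : ι) : Z (b.corootValue i t) / Z (b.corootValue i t + 1) =
        (if i ∈ b.leviBase p then (b.corootValue i t - 1)⁻¹ else 1) *
          (Z' i t / Z (b.corootValue i t + 1)) := by
      simp only [Z']
      split_ifs with hi
      · rw [← mul_div_assoc, ← (ht i hi (hneL i hi)).2]
      · rw [one_mul]
    rw [periodTerm_weightOfCoord, Finset.prod_congr rfl fun i _ => h1 i,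
      Finset.prod_congr rfl fun i _ => h2 i, Finset.prod_mul_distrib, Finset.prod_mul_distrib,
      mul_mul_mul_comm, prod_ite_inv_mul_prod_ite_inv (b.disjoint_preimageBase_inversionSet w) hneL,
      list_prod_inv_eq_prod_leviBase b hl hlp, mul_assoc]
  · split_ifs with hw
    · have hres : residueAt Z 1 = h 1 := residueAt_eq_of_simplePole hh hpole
      have hB : ∏ i ∈ b.preimageBase w, E' i t₀ =
          (1 / (Real.log q : ℂ)) ^
              Finset.card {i ∈ b.leviBase p | P.weylGroupToPerm w i ∈ b.support} *
            ∏ i with P.weylGroupToPerm w i ∈ b.support ∧ i ∉ b.leviBase p,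
              1 / (1 - (q : ℂ) ^ (-(b.corootCoeff p i * s) - b.corootHeight i + 1)) := by
        rw [← Finset.prod_filter_mul_prod_filter_not _ (· ∈ b.leviBase p), preimageBase,
          Finset.filter_filter, Finset.filter_filter, ← Finset.prod_const]
        congr 1
        · refine Finset.prod_congr (by ext i; simp [and_comm]) fun i hi => ?_
          have hiL : i ∈ b.leviBase p := (Finset.mem_filter.1 hi).1
          simp only [E', if_pos hiL, hvL hiL, sub_self, he0]
        · refine Finset.prod_congr rfl fun i hi => ?_
          have hiL : i ∉ b.leviBase p := (Finset.mem_filter.1 hi).2.2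
          simp only [E', if_neg hiL]
          rw [ht₀, corootValue_single]
          congr 4
          ring
      have hI : ∏ i ∈ b.inversionSet w, Z' i t₀ / Z (b.corootValue i t₀ + 1) =
          residueAt Z 1 ^ (b.inversionSet w ∩ b.leviBase p).card *
            (zetaProduct Z (b.zetaNumerator p w) s /
              zetaProduct Z (b.zetaDenominator p w) s) := by
        rw [Finset.prod_div_distrib, ← mul_div_assoc]
        congr 1
        · rw [← Finset.prod_inter_mul_prod_sdiff _ (b.leviBase p), ← Finset.prod_const,
            zetaProduct, zetaNumerator, Multiset.map_map]
          congr 1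
          · refine Finset.prod_congr rfl fun i hi => ?_
            have hiL : i ∈ b.leviBase p := (Finset.mem_inter.1 hi).2
            simp only [Z', if_pos hiL, hvL hiL, hres]
          · refine Finset.prod_congr rfl fun i hi => ?_
            have hiL : i ∉ b.leviBase p := (Finset.mem_sdiff.1 hi).2
            simp only [Z', if_neg hiL]
            rw [ht₀, corootValue_single]
            rfl
        · rw [zetaProduct, zetaDenominator, Multiset.map_map]
          refine Finset.prod_congr rfl fun i hi => ?_
          rw [ht₀, corootValue_single, add_assoc]
          rfl
      simp only
      rw [(b.leviBase_sdiff_eq_empty_iff p w).2 hw, Finset.prod_empty, one_mul, hB, hI,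
        residueTerm]
      ring
    -- Some α_j ∈ Δ_p produces no pole; its compensating factor t_j vanishes at the base point.
    · obtain ⟨i, hi⟩ := Finset.nonempty_iff_ne_empty.2
        (mt (b.leviBase_sdiff_eq_empty_iff p w).1 hw)
      simp only
      rw [Finset.prod_eq_zero hi, zero_mul]
      rw [hvL (Finset.mem_sdiff.1 hi).1, sub_self]

theorem parabolicResidue_periodTerm (hq : 1 < q) (hZ : IsZetaLike Z) (hl : l.Nodup)
    (hlp : ∀ j, j ∈ l ↔ j ≠ p) (w : P.weylGroup) :
    b.parabolicResidue p l (b.periodTerm q Z w) =ᶠ[Filter.codiscrete ℂ]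
      fun s => if w ∈ b.specialWeyl p then b.residueTerm q Z p w s else 0 := by
  filter_upwards [b.exists_regularPart_periodTerm hq hZ hl hlp w] with s ⟨H, h1, h2, h3⟩
  rw [← h3]
  exact iteratedResidue_eq_of_simplePoles hl
    (fun j hj => by rw [Pi.single_eq_of_ne ((hlp j).1 hj)]) h1 h2

/-- The regular parts are summed over w before the residue is taken, so no additivity of iterated
residues is required. -/
theorem parabolicPeriod_eq (hq : 1 < q) (hZ : IsZetaLike Z) (hl : l.Nodup)
    (hlp : ∀ j, j ∈ l ↔ j ≠ p) :
    b.parabolicPeriod q Z p l =ᶠ[Filter.codiscrete ℂ]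
      fun s => ∑ᶠ w ∈ b.specialWeyl p, b.residueTerm q Z p w s := by
  have := Fintype.ofFinite P.weylGroup
  filter_upwards [Filter.eventually_all.2 fun w =>
    b.exists_regularPart_periodTerm hq hZ hl hlp w] with s hs
  choose H h1 h2 h3 using hs
  have key : b.parabolicPeriod q Z p l s = ∑ w, H w (Pi.single p s) := by
    refine iteratedResidue_eq_of_simplePoles (H := fun t => ∑ w, H w t) hl
      (fun j hj => by rw [Pi.single_eq_of_ne ((hlp j).1 hj)])
      (Finset.analyticAt_fun_sum _ fun w _ => h1 w) ?_
    filter_upwards [Filter.eventually_all.2 h2] with t ht hne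
    rw [period, finsum_eq_sum_of_fintype, Finset.mul_sum]
    exact Finset.sum_congr rfl fun w _ => ht w hne
  rw [key, finsum_eq_sum_of_fintype]
  refine Finset.sum_congr rfl fun w _ => ?_
  rw [h3, finsum_eq_if]

end RootPairing.Base

/-! ### Growth of power sums -/

/-- A polynomial L vanishing at every value of ω except ω_i turns a fixed combination of shifted
power sums into A ω_i^m, where A ≠ 0 is L(ω_i) times the multiplicity of ω_i. So |ω_i|^m = O(q^m).
-/
theorem norm_le_of_norm_sum_pow_le {n : ℕ} {ω : Fin n → ℂ} {q C : ℝ} (hq : 0 < q)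
    (h : ∀ m : ℕ, 1 ≤ m → ‖∑ i, ω i ^ m‖ ≤ C * q ^ m) (i : Fin n) : ‖ω i‖ ≤ q := by
  classical
  by_contra! hlt
  set L : ℂ[X] := ∏ ν ∈ (Finset.univ.image ω).erase (ω i), (Polynomial.X - Polynomial.C ν) with hL
  have hL0 (j : Fin n) (hj : ω j ≠ ω i) : L.eval (ω j) = 0 := by
    rw [hL, Polynomial.eval_prod]
    exact Finset.prod_eq_zero
      (Finset.mem_erase.2 ⟨hj, Finset.mem_image_of_mem _ (Finset.mem_univ j)⟩) (by simp)
  have hL1 : L.eval (ω i) ≠ 0 := by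
    rw [hL, Polynomial.eval_prod, Finset.prod_ne_zero_iff]
    intro ν hν
    simpa [sub_eq_zero] using (Finset.mem_erase.1 hν).1.symm
  set A : ℂ := (Finset.univ.filter fun j => ω j = ω i).card * L.eval (ω i) with hA
  have hA0 : A ≠ 0 := by
    refine mul_ne_zero ?_ hL1
    rw [Nat.cast_ne_zero, Finset.card_ne_zero]
    exact ⟨i, by simp⟩
  have hsum (m : ℕ) : ∑ k ∈ Finset.range (L.natDegree + 1), L.coeff k * ∑ j, ω j ^ (m + k) =
      A * ω i ^ m := by
    have h1 : ∑ k ∈ Finset.range (L.natDegree + 1), L.coeff k * ∑ j, ω j ^ (m + k) =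
        ∑ j, ω j ^ m * L.eval (ω j) := by
      simp_rw [Polynomial.eval_eq_sum_range, Finset.mul_sum]
      rw [Finset.sum_comm]
      refine Finset.sum_congr rfl fun j _ => Finset.sum_congr rfl fun k _ => ?_
      ring
    have h2 (j : Fin n) : ω j ^ m * L.eval (ω j) =
        if ω j = ω i then ω i ^ m * L.eval (ω i) else 0 := by
      split_ifs with hj
      · rw [hj]
      · rw [hL0 j hj, mul_zero]
    rw [h1, Finset.sum_congr rfl fun j _ => h2 j, ← Finset.sum_filter, Finset.sum_const,
      nsmul_eq_mul, hA]
    ring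
  set D : ℝ := ∑ k ∈ Finset.range (L.natDegree + 1), ‖L.coeff k‖ * (C * q ^ k) with hD
  have hbound (m : ℕ) (hm : 1 ≤ m) : ‖A‖ * ‖ω i‖ ^ m ≤ D * q ^ m := by
    rw [← norm_pow, ← norm_mul, ← hsum m, hD, Finset.sum_mul]
    refine (norm_sum_le _ _).trans (Finset.sum_le_sum fun k _ => ?_)
    rw [norm_mul, mul_assoc, mul_assoc, ← pow_add, add_comm k m]
    exact mul_le_mul_of_nonneg_left (h (m + k) (by omega)) (norm_nonneg _)
  have hr : 1 < ‖ω i‖ / q := (one_lt_div hq).2 hlt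
  obtain ⟨m, hm⟩ := pow_unbounded_of_one_lt (D / ‖A‖) hr
  have hmm : (‖ω i‖ / q) ^ m ≤ (‖ω i‖ / q) ^ (m + 1) := pow_le_pow_right₀ hr.le (by omega)
  have h1 := hbound (m + 1) (by omega)
  have hApos : 0 < ‖A‖ := norm_pos_iff.2 hA0
  have h2 := hm.trans_le hmm
  rw [div_pow, div_lt_div_iff₀ hApos (by positivity)] at h2
  linarith

/-! ### Counting points of curves over finite fields -/

/-- Lying over lifts the smallest prime of a chain, and going up lifts the rest. -/
theorem ringKrullDim_le_of_injective_of_isIntegral {R S : Type*} [CommRing R] [CommRing S]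
    [Algebra R S] [Algebra.IsIntegral R S] (hinj : Function.Injective (algebraMap R S)) :
    ringKrullDim R ≤ ringKrullDim S := by
  refine iSup_le fun c => ?_
  obtain ⟨Q, -, hQ, hQc⟩ := Ideal.exists_ideal_over_prime_of_isIntegral c.head.asIdeal
    (⊥ : Ideal S)
    (by simp [← RingHom.ker_eq_comap_bot, (RingHom.injective_iff_ker_eq_bot _).1 hinj])
  have : Q.LiesOver c.head.asIdeal := ⟨hQc.symm⟩
  obtain ⟨L, hL, -⟩ := Ideal.exists_ltSeries_of_hasGoingUp c Q
  rw [← hL]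
  exact le_iSup (fun L : LTSeries (PrimeSpectrum S) => (L.length : WithBot ℕ∞)) L

/-- A finitely generated algebra of dimension at most one over a field has `O(#K)` points over
finite extensions `K` of the field. -/
theorem exists_card_algHom_le (k A : Type*) [Field k] [CommRing A] [Algebra k A]
    [Algebra.FiniteType k A] (hdim : ringKrullDim A ≤ 1) :
    ∃ C : ℕ, ∀ (K : Type u) [Field K] [Algebra k K] [Finite K],
      Finite (A →ₐ[k] K) ∧ Nat.card (A →ₐ[k] K) ≤ C * Nat.card K := by
  classical
  rcases subsingleton_or_nontrivial A with hA | hA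
  · refine ⟨0, fun K _ _ _ => ?_⟩
    have : IsEmpty (A →ₐ[k] K) := ⟨fun φ => zero_ne_one (α := K) (by
      rw [← map_zero φ, ← map_one φ, Subsingleton.elim (0 : A) 1])⟩
    exact ⟨inferInstance, by simp⟩
  -- Noether normalization: A is finite over a polynomial ring in n variables, and the dimension
  -- bound gives n ≤ 1.
  obtain ⟨n, g, hg, hfin⟩ := exists_finite_inj_algHom_of_fg k A
  let _ : Algebra (MvPolynomial (Fin n) k) A := g.toRingHom.toAlgebra
  have hmf : Module.Finite (MvPolynomial (Fin n) k) A := hfin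
  have hn : n ≤ 1 := by
    have h1 := (ringKrullDim_le_of_injective_of_isIntegral
      (R := MvPolynomial (Fin n) k) (S := A) hg).trans hdim
    rw [MvPolynomial.ringKrullDim_of_isNoetherianRing, ringKrullDim_eq_zero_of_field, zero_add,
      Nat.card_fin] at h1
    exact_mod_cast h1
  obtain ⟨G, hG⟩ := hmf.fg_top
  have hintegral (a : A) : ∃ p : (MvPolynomial (Fin n) k)[X], p.Monic ∧ p.eval₂ g.toRingHom a = 0 :=
    Algebra.IsIntegral.isIntegral (R := MvPolynomial (Fin n) k) a
  choose p hp hpa using hintegral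
  refine ⟨∏ a : G, (p a).natDegree, fun K _ _ _ => ?_⟩
  have := Fintype.ofFinite K
  have hext {φ ψ : A →ₐ[k] K} (h1 : φ.comp g = ψ.comp g) (h2 : ∀ a ∈ G, φ a = ψ a) : φ = ψ := by
    ext x
    have hx : x ∈ Submodule.span (MvPolynomial (Fin n) k) (G : Set A) := by rw [hG]; trivial
    induction hx using Submodule.span_induction with
    | mem a ha => exact h2 a ha
    | zero => simp
    | add x y _ _ hx hy => rw [map_add, map_add, hx, hy]
    | smul c x _ hx =>
      have hc : φ (g c) = ψ (g c) := AlgHom.congr_fun h1 c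
      have : c • x = g c * x := rfl
      rw [this, map_mul, map_mul, hx, hc]
  let res : (A →ₐ[k] K) → (Fin n → K) := fun φ i => φ (g (MvPolynomial.X i))
  have hres {φ ψ : A →ₐ[k] K} (h : res φ = res ψ) : φ.comp g = ψ.comp g :=
    MvPolynomial.algHom_ext fun i => congrFun h i
  have hfinite : Finite (A →ₐ[k] K) := by
    refine Finite.of_injective (β := (Fin n → K) × (G → K)) (fun φ => (res φ, fun a => φ a)) ?_
    intro φ ψ h
    rw [Prod.mk.injEq] at h
    exact hext (hres h.1) fun a ha => congrFun h.2 ⟨a, ha⟩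
  refine ⟨hfinite, ?_⟩
  have := Fintype.ofFinite (A →ₐ[k] K)
  rw [Nat.card_eq_fintype_card, Nat.card_eq_fintype_card, ← Finset.card_univ]
  -- Once the images of the coordinates are fixed, each module generator must map to a root of its
  -- specialized monic equation. This bounds the fibre by the product of degrees, independently of
  -- K.
  have hfib : ∀ y ∈ Finset.univ.image res,
      (Finset.univ.filter fun φ => res φ = y).card ≤ ∏ a : G, (p a).natDegree := by
    intro y hy
    obtain ⟨φ₀, -, rfl⟩ := Finset.mem_image.1 hy
    let roots (a : G) : Finset K := ((p a).map (φ₀.comp g).toRingHom).roots.toFinset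
    have hroots (a : G) : (roots a).card ≤ (p a).natDegree := by
      refine (Multiset.toFinset_card_le _).trans ((Polynomial.card_roots' _).trans ?_)
      exact Polynomial.natDegree_map_le
    refine (Finset.card_le_card_of_injOn (t := Fintype.piFinset roots)
      (fun φ a => φ a) ?_ ?_).trans ?_
    · intro φ hφ
      have hφ' : φ.comp g = φ₀.comp g := hres (Finset.mem_filter.1 hφ).2
      rw [Finset.mem_coe, Fintype.mem_piFinset]
      intro a
      rw [Multiset.mem_toFinset, Polynomial.mem_roots ((hp a).map _).ne_zero,
        Polynomial.IsRoot.def, Polynomial.eval_map, ← hφ']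
      have := congrArg φ (hpa a)
      rw [map_zero] at this
      rw [← this]
      exact (Polynomial.hom_eval₂ _ g.toRingHom φ.toRingHom _).symm
    · intro φ hφ ψ hψ h
      refine hext (hres ((Finset.mem_filter.1 hφ).2.trans (Finset.mem_filter.1 hψ).2.symm))
        fun a ha => congrFun h ⟨a, ha⟩
    · rw [Fintype.card_piFinset]
      exact Finset.prod_le_prod' fun a _ => hroots a
  refine (Finset.card_le_mul_card_image _ _ hfib).trans (Nat.mul_le_mul_left _ ?_)
  refine (Finset.card_le_univ _).trans ?_
  rw [Fintype.card_fun, Fintype.card_fin]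
  calc Fintype.card K ^ n ≤ Fintype.card K ^ 1 :=
        Nat.pow_le_pow_right Fintype.card_pos hn
    _ = Fintype.card K := pow_one _

/-- The elements fixed by the n-th power of Frobenius form a subalgebra containing the roots, hence
everything; so every element is a root of a polynomial of degree q^n. -/
theorem card_splittingField_X_pow_sub_X_le (k : Type*) [Field k] [Finite k] {n : ℕ}
    (hn : 1 ≤ n) :
    Finite (Polynomial.X ^ Nat.card k ^ n - Polynomial.X : k[X]).SplittingField ∧
    Nat.card (Polynomial.X ^ Nat.card k ^ n - Polynomial.X : k[X]).SplittingField ≤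
      Nat.card k ^ n := by
  classical
  have := Fintype.ofFinite k
  set F : k[X] := Polynomial.X ^ Nat.card k ^ n - Polynomial.X with hF
  have hq : 1 < Nat.card k ^ n := Nat.one_lt_pow (by omega) Finite.one_lt_card
  have hfin : Finite F.SplittingField := Module.finite_of_finite k
  have := Fintype.ofFinite F.SplittingField
  refine ⟨hfin, ?_⟩
  have hF0 : F.map (algebraMap k F.SplittingField) ≠ 0 := by
    rw [Polynomial.map_ne_zero_iff (algebraMap k F.SplittingField).injective]
    exact FiniteField.X_pow_card_sub_X_ne_zero k hq
  have hroot (x : F.SplittingField) :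
      x ∈ (F.map (algebraMap k F.SplittingField)).roots ↔ x ^ Nat.card k ^ n = x := by
    rw [Polynomial.mem_roots hF0]
    simp [hF, sub_eq_zero]
  have hpow (x : F.SplittingField) :
      ((FiniteField.frobeniusAlgHom k F.SplittingField) ^ n) x = x ^ Nat.card k ^ n := by
    rw [AlgHom.coe_pow, FiniteField.coe_frobeniusAlgHom, pow_iterate, Nat.card_eq_fintype_card]
  have hall (x : F.SplittingField) : x ^ Nat.card k ^ n = x := by
    have htop : AlgHom.equalizer ((FiniteField.frobeniusAlgHom k F.SplittingField) ^ n)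
        (AlgHom.id k F.SplittingField) = ⊤ := by
      rw [eq_top_iff, ← Polynomial.SplittingField.adjoin_rootSet F, Algebra.adjoin_le_iff]
      intro y hy
      rw [SetLike.mem_coe, AlgHom.mem_equalizer, hpow, AlgHom.id_apply]
      rw [Polynomial.rootSet_def, Finset.mem_coe, Multiset.mem_toFinset] at hy
      exact (hroot y).1 hy
    have hx : x ∈ AlgHom.equalizer ((FiniteField.frobeniusAlgHom k F.SplittingField) ^ n)
        (AlgHom.id k F.SplittingField) := by rw [htop]; trivial
    rw [AlgHom.mem_equalizer, hpow, AlgHom.id_apply] at hx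
    exact hx
  rw [Nat.card_eq_fintype_card, ← Finset.card_univ]
  calc Finset.univ.card ≤ (F.map (algebraMap k F.SplittingField)).roots.toFinset.card :=
        Finset.card_le_card fun x _ => Multiset.mem_toFinset.2 ((hroot x).2 (hall x))
    _ ≤ F.natDegree := (Multiset.toFinset_card_le _).trans
        ((Polynomial.card_roots' _).trans Polynomial.natDegree_map_le)
    _ = Nat.card k ^ n := FiniteField.X_pow_card_sub_X_natDegree_eq k hq

/-! ### Points of schemes of dimension at most one -/

section Curve

theorem exists_card_points_in_chart_le {k : Type u} [Field k] {X : Scheme.{u}}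
    (f : X ⟶ Spec (.of k)) [LocallyOfFiniteType f] (hdim : topologicalKrullDim X ≤ 1)
    {R : CommRingCat.{u}} (j : Spec R ⟶ X) [IsOpenImmersion j] :
    ∃ C : ℕ, ∀ (K : Type u) [Field K] [Algebra k K] [Finite K],
      Finite {x : Spec (.of K) ⟶ X // x ≫ f = Spec.map (CommRingCat.ofHom (algebraMap k K)) ∧
        Set.range x ⊆ Set.range j} ∧
      Nat.card {x : Spec (.of K) ⟶ X // x ≫ f = Spec.map (CommRingCat.ofHom (algebraMap k K)) ∧
        Set.range x ⊆ Set.range j} ≤ C * Nat.card K := by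
  obtain ⟨φ, hφ⟩ := Spec.map_surjective (j ≫ f)
  let _ : Algebra k R := φ.hom.toAlgebra
  have hft : Algebra.FiniteType k R := by
    have h1 : LocallyOfFiniteType (Spec.map φ) := by rw [hφ]; infer_instance
    exact (HasRingHomProperty.Spec_iff (P := @LocallyOfFiniteType)).1 h1
  have hR : ringKrullDim R ≤ 1 := by
    rw [← PrimeSpectrum.topologicalKrullDim_eq_ringKrullDim]
    exact (j.isOpenEmbedding.isInducing.topologicalKrullDim_le).trans hdim
  obtain ⟨C, hC⟩ := exists_card_algHom_le k R hR
  refine ⟨C, fun K _ _ _ => ?_⟩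
  obtain ⟨h1, h2⟩ := hC K
  have key (x : {x : Spec (.of K) ⟶ X // x ≫ f = Spec.map (CommRingCat.ofHom (algebraMap k K)) ∧
      Set.range x ⊆ Set.range j}) :
      ∃ ψ : R →ₐ[k] K, Spec.map (CommRingCat.ofHom ψ.toRingHom) ≫ j = x.1 := by
    obtain ⟨x, hx, hxj⟩ := x
    obtain ⟨ψ, hψ⟩ := Spec.map_surjective (IsOpenImmersion.lift j x hxj)
    have hcomp : φ ≫ ψ = CommRingCat.ofHom (algebraMap k K) := by
      apply Spec.map_injective
      rw [Spec.map_comp, hφ, hψ, ← Category.assoc, IsOpenImmersion.lift_fac, hx]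
    refine ⟨⟨ψ.hom, fun a => ?_⟩, ?_⟩
    · exact congrArg (fun θ => θ.hom a) hcomp
    · have : CommRingCat.ofHom ψ.hom = ψ := rfl
      change Spec.map (CommRingCat.ofHom ψ.hom) ≫ j = x
      rw [this, hψ, IsOpenImmersion.lift_fac]
  choose F hF using key
  have hinj : Function.Injective F := by
    intro x y h
    apply Subtype.ext
    rw [← hF x, ← hF y, h]
  exact ⟨Finite.of_injective F hinj, (Nat.card_le_card_of_injective F hinj).trans h2⟩

/-- A K-point has a single point as image, so it factors through one of finitely many affine charts,
where it is a k-algebra homomorphism to K. -/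
theorem exists_card_points_le {k : Type u} [Field k] {X : Scheme.{u}}
    (f : X ⟶ Spec (.of k)) [LocallyOfFiniteType f] [CompactSpace X]
    (hdim : topologicalKrullDim X ≤ 1) :
    ∃ C : ℕ, ∀ (K : Type u) [Field K] [Algebra k K] [Finite K],
      Nat.card {x : Spec (.of K) ⟶ X // x ≫ f = Spec.map (CommRingCat.ofHom (algebraMap k K))} ≤
        C * Nat.card K := by
  classical
  let 𝒰 := X.affineOpenCover
  obtain ⟨S, hS⟩ := isCompact_univ.elim_finite_subcover (fun i : 𝒰.I₀ => Set.range (𝒰.f i))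
    (fun i => (𝒰.f i).isOpenEmbedding.isOpen_range)
    (fun x _ => Set.mem_iUnion.2 ⟨𝒰.idx x, 𝒰.covers x⟩)
  choose C hC using fun i : 𝒰.I₀ => exists_card_points_in_chart_le f hdim (𝒰.f i)
  refine ⟨∑ i : S, C i, fun K _ _ _ => ?_⟩
  let T (i : S) := {x : Spec (.of K) ⟶ X //
    x ≫ f = Spec.map (CommRingCat.ofHom (algebraMap k K)) ∧ Set.range x ⊆ Set.range (𝒰.f i)}
  have hT (i : S) : Finite (T i) := (hC i K).1
  have key (x : {x : Spec (.of K) ⟶ X //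
      x ≫ f = Spec.map (CommRingCat.ofHom (algebraMap k K))}) : ∃ y : Σ i, T i, y.2.1 = x.1 := by
    obtain ⟨x, hx⟩ := x
    have : Subsingleton (Spec (.of K)) := inferInstanceAs (Subsingleton (PrimeSpectrum K))
    let pt : Spec (.of K) := (default : PrimeSpectrum K)
    obtain ⟨i, hi, hxi⟩ := Set.mem_iUnion₂.1 (hS (Set.mem_univ (x pt)))
    refine ⟨⟨⟨i, hi⟩, ⟨x, hx, ?_⟩⟩, rfl⟩
    rintro _ ⟨y, rfl⟩
    rwa [Subsingleton.elim y pt]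
  choose F hF using key
  have hinj : Function.Injective F := by
    intro x y h
    apply Subtype.ext
    rw [← hF x, ← hF y, h]
  refine (Nat.card_le_card_of_injective F hinj).trans ?_
  rw [Nat.card_sigma, Finset.sum_mul]
  exact Finset.sum_le_sum fun i _ => (hC i K).2

-- Finiteness of projective space and the bound on Frobenius eigenvalues

attribute [local instance] MvPolynomial.gradedAlgebra

theorem algebraMap_homogeneousSubmodule_zero_surjective (k : Type u) [Field k] (n : ℕ) :
    Function.Surjective
      (algebraMap k (MvPolynomial.homogeneousSubmodule (Fin (n + 1)) k 0)) := by
  rintro ⟨x, hx⟩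
  have h0 : x.totalDegree = 0 := by
    have := MvPolynomial.IsHomogeneous.totalDegree_le (σ := Fin (n + 1)) (R := k) hx
    omega
  refine ⟨x.coeff 0, Subtype.ext ?_⟩
  exact (MvPolynomial.totalDegree_eq_zero_iff_eq_C.1 h0).symm

instance finiteType_homogeneousSubmodule_zero (k : Type u) [Field k] (n : ℕ) :
    Algebra.FiniteType (MvPolynomial.homogeneousSubmodule (Fin (n + 1)) k 0)
      (MvPolynomial (Fin (n + 1)) k) := by
  classical
  refine ⟨⟨Finset.univ.image MvPolynomial.X, eq_top_iff.2 fun x _ => ?_⟩⟩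
  induction x using MvPolynomial.induction_on with
  | C a =>
    exact Subalgebra.algebraMap_mem _
      (⟨MvPolynomial.C a, MvPolynomial.isHomogeneous_C _ a⟩ :
        MvPolynomial.homogeneousSubmodule (Fin (n + 1)) k 0)
  | add x y hx hy => exact add_mem (hx trivial) (hy trivial)
  | mul_X x i hx => exact mul_mem (hx trivial) (Algebra.subset_adjoin (by simp))

instance locallyOfFiniteType_projectiveSpaceHom (k : Type u) [Field k] (n : ℕ) :
    LocallyOfFiniteType (projectiveSpaceHom k n) := by
  have h2 : LocallyOfFiniteType (Spec.map (CommRingCat.ofHom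
      (algebraMap k (MvPolynomial.homogeneousSubmodule (Fin (n + 1)) k 0)))) := by
    rw [HasRingHomProperty.Spec_iff (P := @LocallyOfFiniteType)]
    exact RingHom.FiniteType.of_surjective _ (algebraMap_homogeneousSubmodule_zero_surjective k n)
  unfold projectiveSpaceHom
  infer_instance

instance quasiCompact_projectiveSpaceHom (k : Type u) [Field k] (n : ℕ) :
    QuasiCompact (projectiveSpaceHom k n) := by
  unfold projectiveSpaceHom
  infer_instance

variable {k : Type u} [Field k] {X : Scheme.{u}} {f : X ⟶ Spec (.of k)}

theorem IsRegularProjectiveCurve.locallyOfFiniteType (hX : IsRegularProjectiveCurve f) :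
    LocallyOfFiniteType f := by
  obtain ⟨n, i, hi, rfl⟩ := hX.projective
  infer_instance

theorem IsRegularProjectiveCurve.compactSpace (hX : IsRegularProjectiveCurve f) :
    CompactSpace X := by
  have : QuasiCompact f := by
    obtain ⟨n, i, hi, rfl⟩ := hX.projective
    infer_instance
  exact QuasiCompact.compactSpace_of_compactSpace f

theorem IsRegularProjectiveCurve.exists_pointCount_le [Finite k]
    (hX : IsRegularProjectiveCurve f) :
    ∃ C : ℕ, ∀ n : ℕ, 1 ≤ n → pointCount f n ≤ C * Nat.card k ^ n := by
  have := hX.locallyOfFiniteType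
  have := hX.compactSpace
  obtain ⟨C, hC⟩ := exists_card_points_le f hX.dim_eq_one.le
  refine ⟨C, fun n hn => ?_⟩
  obtain ⟨hfin, hcard⟩ := card_splittingField_X_pow_sub_X_le k hn
  exact (hC _).trans (Nat.mul_le_mul_left C hcard)

theorem IsRegularProjectiveCurve.norm_frobeniusEigenvalues_le [Finite k]
    (hX : IsRegularProjectiveCurve f) (i : Fin (2 * curveGenus f)) :
    ‖frobeniusEigenvalues f i‖ ≤ Nat.card k := by
  by_cases h : ∃ ω : Fin (2 * curveGenus f) → ℂ, ∀ n : ℕ, 1 ≤ n →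
      (pointCount f n : ℂ) = (Nat.card k : ℂ) ^ n + 1 - ∑ i, ω i ^ n
  · have hspec := h.choose_spec
    rw [frobeniusEigenvalues, dif_pos h]
    set ω := h.choose
    obtain ⟨C, hC⟩ := hX.exists_pointCount_le
    have hq : (1 : ℝ) < Nat.card k := by exact_mod_cast Finite.one_lt_card
    -- The 2 absorbs q^m + 1 ≤ 2 q^m; C comes from the point count.
    refine norm_le_of_norm_sum_pow_le (C := C + 2) (by linarith) (fun m hm => ?_) i
    have hsum : ∑ i, ω i ^ m = (Nat.card k : ℂ) ^ m + 1 - pointCount f m := by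
      rw [hspec m hm]
      ring
    have hpc : (pointCount f m : ℝ) ≤ C * (Nat.card k : ℝ) ^ m := by exact_mod_cast hC m hm
    have hone : (1 : ℝ) ≤ (Nat.card k : ℝ) ^ m := one_le_pow₀ hq.le
    rw [hsum]
    refine (norm_sub_le _ _).trans ?_
    have h1 : ‖(Nat.card k : ℂ) ^ m + 1‖ ≤ (Nat.card k : ℝ) ^ m + 1 := by
      refine (norm_add_le _ _).trans ?_
      simp
    rw [Complex.norm_natCast]
    linarith
  -- The default eigenvalues are 0, for which the bound is trivial; existence of true eigenvalues is
  -- never needed.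
  · rw [frobeniusEigenvalues, dif_neg h]
    simp

theorem IsRegularProjectiveCurve.isZetaLike_completeZeta [Finite k]
    (hX : IsRegularProjectiveCurve f) : IsZetaLike (completeZeta f) :=
  isZetaLike_of_norm_le Finite.one_lt_card _ hX.norm_frobeniusEigenvalues_le

end Curve

theorem theorem6 {k : Type u} [Field k] [Finite k] {X : Scheme.{u}} (f : X ⟶ Spec (.of k))
    (hX : IsRegularProjectiveCurve f)
    {ι M N : Type*} [Fintype ι] [AddCommGroup M] [Module ℂ M] [AddCommGroup N] [Module ℂ N]
    (P : RootPairing ι ℂ M N) [P.IsRootSystem] [P.IsCrystallographic] [P.IsReduced]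
    (b : P.Base) (p : b.support)
    (l : List b.support) (hl : l.Nodup) (hlp : ∀ j, j ∈ l ↔ j ≠ p) :
    -- the residue of the period reduces to a sum over `𝔚_p`
    ((∀ w ∉ b.specialWeyl p,
        b.parabolicResidue p l (b.periodTerm (Nat.card k) (completeZeta f) w)
          =ᶠ[Filter.codiscrete ℂ] fun _ => 0) ∧
      (∀ w ∈ b.specialWeyl p,
        b.parabolicResidue p l (b.periodTerm (Nat.card k) (completeZeta f) w)
          =ᶠ[Filter.codiscrete ℂ] b.residueTerm (Nat.card k) (completeZeta f) p w) ∧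
      b.parabolicPeriod (Nat.card k) (completeZeta f) p l
        =ᶠ[Filter.codiscrete ℂ]
          fun s => ∑ᶠ w ∈ b.specialWeyl p, b.residueTerm (Nat.card k) (completeZeta f) p w s) ∧
    -- there is exactly one minimal family of normalizing zeta factors, given by root counting
    (∃! m, b.IsMinimalNormalization p m) ∧
    (∀ a c : ℕ, 2 ≤ c →
      ((b.minimalFactors p).count ((a : ℂ), (c : ℂ)) : ℤ) = b.countM p a c) ∧
    (∀ x ∈ b.minimalFactors p, ∃ a c : ℕ, 2 ≤ c ∧ x = ((a : ℂ), (c : ℂ))) ∧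
    -- the formula for the zeta function of `(G,P)`
    (∀ s : ℂ, b.groupZeta (Nat.card k) (completeZeta f) p l s =
      b.parabolicPeriod (Nat.card k) (completeZeta f) p l s *
        ∏ᶠ (a : ℕ) (c : ℕ) (_ : 2 ≤ c), completeZeta f (a * s + c) ^ b.countM p a c) := by

  have hq : 1 < Nat.card k := Finite.one_lt_card
  have hZ := hX.isZetaLike_completeZeta
  have hcount (a c : ℕ) (hc : 2 ≤ c) :
      ((b.minimalFactors p).count ((a : ℂ), (c : ℂ)) : ℤ) = b.countM p a c := by
    rw [b.minimalFactors_eq p]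
    exact b.count_leastFactors p a hc
  have hmem (x) (hx : x ∈ b.minimalFactors p) : ∃ a c : ℕ, 2 ≤ c ∧ x = ((a : ℂ), (c : ℂ)) := by
    rw [b.minimalFactors_eq p] at hx
    exact RootPairing.Base.mem_leastFactors hx
  refine ⟨⟨fun w hw => ?_, fun w hw => ?_, b.parabolicPeriod_eq hq hZ hl hlp⟩,
    b.existsUnique_isMinimalNormalization p, hcount, hmem, fun s => ?_⟩
  · simpa [hw] using b.parabolicResidue_periodTerm hq hZ hl hlp w
  · simpa [hw] using b.parabolicResidue_periodTerm hq hZ hl hlp w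
  · rw [RootPairing.Base.groupZeta, mul_comm,
      RootPairing.Base.zetaProduct_eq_finprod (e := fun a c => b.countM p a c) hmem hcount]
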